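/- All graphs are finite and simple. For $P=(x,y)$ in $\mathbb{R}^2$ or $\mathbb{C}^2$ put $d(P)=x^2+y^2$. A real (complex) realisation of a graph $G=(V,E)$ is a map $p$ from $V$ to $\mathbb{R}^2$ (to $\mathbb{C}^2$); it is generic if its $2|V|$ coordinates are algebraically independent over $\mathbb{Q}$. Realisations $p,q$ of $G$ are equivalent if $d(p(u)-p(v))=d(q(u)-q(v))$ for all $uv\in E$, and congruent if this holds for all $u,v\in V$. A real realisation $p$ of $G$ is rigid if there is $\epsilon>0$ such that every real realisation $q$ that is equivalent to $p$ and satisfies $d(p(v)-q(v))<\epsilon$ for all $v\in V$ is congruent to $p$. The graph $G$ is rigid if its generic real realisations are rigid. For a rigid graph $G$ with at least three vertices, $c(G)$ denotes the number of congruence classes of complex realisations equivalent to a generic complex realisation $p$ of $G$; this number is finite and does not depend on the choice of $p$. Let $G_1$ and $G_2$ be graphs with $V(G_1)\cap V(G_2)=\emptyset$, let $u_1,u_2,u_3$ be distinct vertices of $G_1$ and $v_1,v_2,v_3$ distinct vertices of $G_2$, and let $G$ be obtained from $G_1\cup G_2$ by adding the three edges $u_1v_1,u_2v_2,u_3v_3$.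 Suppose that $G$ is rigid. Then $G_1$ and $G_2$ are rigid, the numbers $c(G)$, $c(G_1)$, $c(G_2)$ are well defined and finite, and $$c(G)=12\,c(G_1)\,c(G_2).$$ -/

import Mathlib

namespace PlaneFramework

/-- The quadratic form `d(x, y) = x² + y²` on `K²`. -/
def d {K : Type*} [CommRing K] (P : Fin 2 → K) : K := P 0 ^ 2 + P 1 ^ 2

/-- A realisation `p : V → K²` is generic if the family of its `2|V|` coordinates is
algebraically independent over `ℚ`. -/
def IsGeneric {V K : Type*} [CommRing K] [Algebra ℚ K] (p : V → Fin 2 → K) : Prop :=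
  AlgebraicIndependent ℚ fun x : V × Fin 2 => p x.1 x.2

/-- `(G, p)` and `(G, q)` are equivalent: `d(p(u) - p(v)) = d(q(u) - q(v))` for all edges `uv`. -/
def Equivalent {V K : Type*} [CommRing K] (G : SimpleGraph V) (p q : V → Fin 2 → K) : Prop :=
  ∀ u v, G.Adj u v → d (p u - p v) = d (q u - q v)

/-- `p` and `q` are congruent: `d(p(u) - p(v)) = d(q(u) - q(v))` for all vertices `u`, `v`. -/
def Congruent {V K : Type*} [CommRing K] (p q : V → Fin 2 → K) : Prop :=
  ∀ u v, d (p u - p v) = d (q u - q v)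

/-- Rigidity of a real framework `(G, p)`: every equivalent real framework that is close enough
to it is congruent to it. -/
def IsRigidFramework {V : Type*} (G : SimpleGraph V) (p : V → Fin 2 → ℝ) : Prop :=
  ∃ ε : ℝ, 0 < ε ∧ ∀ q : V → Fin 2 → ℝ,
    Equivalent G p q → (∀ v, d (p v - q v) < ε) → Congruent p q

/-- A graph is rigid if its generic real realisations are rigid (some generic realisation exists
and every generic realisation is rigid). -/
def IsRigid {V : Type*} (G : SimpleGraph V) : Prop :=
  (∃ p : V → Fin 2 → ℝ, IsGeneric p) ∧
    ∀ p : V → Fin 2 → ℝ, IsGeneric p → IsRigidFramework G p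

/-- Congruence as an equivalence relation on the complex realisations of `G` that are equivalent
to `(G, p)`. -/
def congruenceSetoid {V : Type*} (G : SimpleGraph V) (p : V → Fin 2 → ℂ) :
    Setoid {q : V → Fin 2 → ℂ // Equivalent G p q} where
  r q q' := Congruent q.1 q'.1
  iseqv :=
    { refl := fun _ _ _ => rfl
      symm := fun h u v => (h u v).symm
      trans := fun h h' u v => (h u v).trans (h' u v) }

/-- `c(G, p)`: the number of congruence classes of complex realisations of `G` that are
equivalent to `(G, p)`; it is `⊤` if there are infinitely many. -/
noncomputable def numClasses {V : Type*} (G : SimpleGraph V) (p : V → Fin 2 → ℂ) : ℕ∞ :=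
  ENat.card (Quotient (congruenceSetoid G p))

/-- `c(G) = n`: the natural number `n` is the common value of `c(G, p)` over all generic complex
realisations `(G, p)` of `G` (and such realisations exist). -/
def HasRealisationNumber {V : Type*} (G : SimpleGraph V) (n : ℕ) : Prop :=
  (∃ p : V → Fin 2 → ℂ, IsGeneric p) ∧
    ∀ p : V → Fin 2 → ℂ, IsGeneric p → numClasses G p = n

/-- The graph obtained from the disjoint union of `G₁` and `G₂` by adding the three edges
`u i — v i`, `i = 0, 1, 2`. -/
def joinThree {V₁ V₂ : Type*} (G₁ : SimpleGraph V₁) (G₂ : SimpleGraph V₂)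
    (u : Fin 3 → V₁) (v : Fin 3 → V₂) : SimpleGraph (V₁ ⊕ V₂) :=
  (G₁ ⊕g G₂) ⊔
    SimpleGraph.fromEdgeSet (Set.range fun i : Fin 3 => s(Sum.inl (u i), Sum.inr (v i)))

end PlaneFramework

/-! In the isotropic coordinates Z = x + iy, W = x - iy the form d becomes the product ZW. Motions
are then (Z, W) ↦ (λZ + s, λ⁻¹W + t), possibly preceded by an exchange of Z and W, and every
congruence between realisations containing a proper triangle is of this kind
(`IsNormal.exists_motion`).

Rigidity is used only through a rank condition: the squared edge lengths have transcendence degree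
at least 2|V| - 3 over ℚ. A rigid generic framework is isolated once three coordinates are pinned,
and isolation forces the coordinates to be algebraic over the edge lengths and the pinned
coordinates (`mem_closure_of_isolated_in_fibre`). Since 2|V| - 3 is also an upper bound, counting
transcendence degrees passes the condition from G to both parts (`rank_parts`). For a generic
framework the condition gives back rigidity and makes c finite. It depends on the edge lengths
alone, so it holds for every equivalent realisation, generic or not.

For the formula, restrict classes of realisations of G to the two parts and count a fibre
(`card_fibre_restrictClasses`). Both parts are rigid bodies in normal position, and three bars of
given lengths must be fitted between them. Eliminating s and t leaves an equation of degree 6 in λ;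
its roots are simple and admissible because the six triangle coordinates and the three bar lengths
are algebraically independent, again by counting (`independent_of_normal`, `card_motions_eq_six`).
Direct and exchanged placements give 6 + 6 = 12.

Finally c does not depend on the generic point, because field automorphisms of ℂ act transitively on
generic points. -/

open Polynomial in
/-- An algebraic element over a domain of characteristic zero is a simple root of some polynomial. -/
theorem IsAlgebraic.exists_aeval_eq_zero_derivative_ne_zero {C K : Type*} [CommRing C] [IsDomain C]
    [CharZero C] [Field K] [Algebra C K] [FaithfulSMul C K] {x : K} (hx : IsAlgebraic C x) :
    ∃ P : C[X], aeval x P = 0 ∧ aeval x (derivative P) ≠ 0 := by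
  obtain ⟨P, hP0, hP⟩ := hx
  induction h : P.natDegree using Nat.strong_induction_on generalizing P with
  | _ n ih =>
    by_cases hd : aeval x (derivative P) = 0
    -- The derivative is then an annihilating polynomial of smaller degree, nonzero because P is not
    -- constant and the characteristic is zero.
    · have hn : P.natDegree ≠ 0 := fun h0 => by
        rw [eq_C_of_natDegree_eq_zero h0] at hP hP0
        rw [aeval_C, FaithfulSMul.algebraMap_eq_zero_iff] at hP
        simp [hP] at hP0
      have hP' : derivative P ≠ 0 := fun h0 => hn (derivative_eq_zero.mp h0)
      exact ih _ (h ▸ natDegree_derivative_lt hn) _ hP' hd rfl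
    · exact ⟨P, hP, hd⟩

/-! ### Algebraic relations and derivatives at a generic point -/

namespace MvPolynomial

open Polynomial in
/-- If `f(p)` is algebraic over the values `g b (p)` at a generic point `p`, then an algebraic
relation between `f` and the `g b` holds identically. -/
theorem exists_polynomial_relation {ι β K : Type*} [Field K] [CharZero K] {p : ι → K}
    (hp : AlgebraicIndependent ℚ p) (g : β → MvPolynomial ι ℚ) (f : MvPolynomial ι ℚ)
    (hf : IsAlgebraic (Algebra.adjoin ℚ (Set.range fun b => aeval p (g b))) (aeval p f)) :
    ∃ P : (MvPolynomial β ℚ)[X],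
      Polynomial.eval₂ (aeval g : MvPolynomial β ℚ →ₐ[ℚ] _).toRingHom f P = 0 ∧
      Polynomial.eval₂ (aeval fun b => aeval p (g b) : MvPolynomial β ℚ →ₐ[ℚ] K).toRingHom (aeval p f)
        (derivative P) ≠ 0 := by
  obtain ⟨Q, hQ, hQ'⟩ := hf.exists_aeval_eq_zero_derivative_ne_zero
  set φ : MvPolynomial β ℚ →ₐ[ℚ] K := aeval fun b => aeval p (g b) with hφ
  have hr : φ.range = Algebra.adjoin ℚ (Set.range fun b => aeval p (g b)) :=
    (Algebra.adjoin_range_eq_range_aeval _ _).symm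
  let ψ : MvPolynomial β ℚ →ₐ[ℚ] Algebra.adjoin ℚ (Set.range fun b => aeval p (g b)) :=
    φ.codRestrict _ fun x => by rw [← hr]; exact ⟨x, rfl⟩
  have hψ : Function.Surjective ψ.toRingHom := fun y => by
    obtain ⟨x, hx⟩ : (y : K) ∈ φ.range := by rw [hr]; exact y.2
    exact ⟨x, Subtype.ext hx⟩
  obtain ⟨P, rfl⟩ := Polynomial.map_surjective ψ.toRingHom hψ Q
  have key : ∀ R : (MvPolynomial β ℚ)[X],
      Polynomial.aeval (aeval p f) (R.map ψ.toRingHom) = Polynomial.eval₂ φ.toRingHom (aeval p f) R := by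
    intro R
    rw [Polynomial.aeval_def, Polynomial.eval₂_map]
    rfl
  -- The relation holds at p, and a rational polynomial vanishing at a generic point is zero.
  refine ⟨P, hp (?_ : aeval p _ = aeval p _), ?_⟩
  · rw [key] at hQ
    rw [map_zero, ← hQ]
    change (aeval p : MvPolynomial ι ℚ →ₐ[ℚ] K).toRingHom _ = _
    rw [Polynomial.hom_eval₂]
    congr 1
    ext b
    · simp
    · simp [hφ]
  · rw [derivative_map, key] at hQ'
    exact hQ'

open Polynomial in
/-- If `f(p)` is algebraic over the values `g b (p)` at a generic point `p`, then `f` takes only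
finitely many values on the fibre of `g` through `p`. -/
theorem exists_polynomial_of_isAlgebraic {ι β K : Type*} [Field K] [CharZero K] {p : ι → K}
    (hp : AlgebraicIndependent ℚ p) (g : β → MvPolynomial ι ℚ) (f : MvPolynomial ι ℚ)
    (hf : IsAlgebraic (Algebra.adjoin ℚ (Set.range fun b => aeval p (g b))) (aeval p f)) :
    ∃ H : K[X], H ≠ 0 ∧
      ∀ q : ι → K, (∀ b, aeval q (g b) = aeval p (g b)) → H.IsRoot (aeval q f) := by
  obtain ⟨P, h0, h1⟩ := exists_polynomial_relation hp g f hf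
  -- The coefficients of the relation are polynomials in the g b, hence constant on the fibre. The
  -- specialised polynomial is nonzero because its derivative does not vanish at f(p).
  refine ⟨P.map (aeval fun b => aeval p (g b) : MvPolynomial β ℚ →ₐ[ℚ] K).toRingHom, ?_, ?_⟩
  · intro h
    apply h1
    rw [← Polynomial.eval_map, ← derivative_map, h]
    simp
  · intro q hq
    have := congrArg (aeval q : MvPolynomial ι ℚ →ₐ[ℚ] K).toRingHom h0
    rw [Polynomial.hom_eval₂, map_zero] at this
    rw [Polynomial.IsRoot, Polynomial.eval_map, ← this]
    congr 1
    ext b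
    · simp
    · simp [hq]

/-- The derivative of a polynomial `f` at `p` in the direction `v`. -/
noncomputable def dirDeriv {ι K : Type*} [Fintype ι] [Field K] [CharZero K] (p v : ι → K)
    (f : MvPolynomial ι ℚ) : K :=
  ∑ i, aeval p (pderiv i f) * v i

theorem dirDeriv_add {ι K : Type*} [Fintype ι] [Field K] [CharZero K] (p v : ι → K)
    (f g : MvPolynomial ι ℚ) : dirDeriv p v (f + g) = dirDeriv p v f + dirDeriv p v g := by
  simp [dirDeriv, add_mul, Finset.sum_add_distrib]

theorem dirDeriv_mul {ι K : Type*} [Fintype ι] [Field K] [CharZero K] (p v : ι → K)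
    (f g : MvPolynomial ι ℚ) :
    dirDeriv p v (f * g) = aeval p f * dirDeriv p v g + aeval p g * dirDeriv p v f := by
  simp only [dirDeriv, Derivation.leibniz, map_add, smul_eq_mul, map_mul, Finset.mul_sum,
    ← Finset.sum_add_distrib]
  exact Finset.sum_congr rfl fun i _ => by ring

theorem dirDeriv_C {ι K : Type*} [Fintype ι] [Field K] [CharZero K] (p v : ι → K) (a : ℚ) :
    dirDeriv p v (C a) = 0 := by
  simp [dirDeriv]

theorem dirDeriv_X {ι K : Type*} [Fintype ι] [Field K] [CharZero K] (p v : ι → K) (i : ι) :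
    dirDeriv p v (X i) = v i := by
  classical
  simp only [dirDeriv, pderiv_X]
  rw [Finset.sum_eq_single i] <;> simp +contextual

/-- A tangent vector along which all `g b` are stationary is also stationary for every `f` which is
algebraic over the `g b`. -/
theorem dirDeriv_eq_zero_of_isAlgebraic {ι β K : Type*} [Fintype ι] [Field K] [CharZero K]
    {p : ι → K} (hp : AlgebraicIndependent ℚ p) (v : ι → K) (g : β → MvPolynomial ι ℚ)
    (f : MvPolynomial ι ℚ)
    (hf : IsAlgebraic (Algebra.adjoin ℚ (Set.range fun b => aeval p (g b))) (aeval p f))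
    (hg : ∀ b, dirDeriv p v (g b) = 0) : dirDeriv p v f = 0 := by
  obtain ⟨P, h0, h1⟩ := exists_polynomial_relation hp g f hf
  have hc : ∀ c : MvPolynomial β ℚ, dirDeriv p v (aeval g c) = 0 := by
    intro c
    induction c using MvPolynomial.induction_on with
    | C a => simpa [algebraMap_eq] using dirDeriv_C p v a
    | add a b ha hb => rw [map_add, dirDeriv_add, ha, hb, add_zero]
    | mul_X a b ha => rw [map_mul, dirDeriv_mul, ha, aeval_X, hg]; simp
  have hcomp : ∀ c : MvPolynomial β ℚ,
      aeval p (aeval g c) = aeval (fun b => aeval p (g b)) c := by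
    intro c
    rw [← AlgHom.comp_apply, comp_aeval]
  -- Chain rule: the coefficients are stationary along v, so only the derivative in the variable
  -- replaced by f survives. For Q = P the left side is zero and the first factor on the right is
  -- not.
  have key : ∀ Q : Polynomial (MvPolynomial β ℚ),
      dirDeriv p v (Q.eval₂ (aeval g : MvPolynomial β ℚ →ₐ[ℚ] _).toRingHom f) =
      Q.derivative.eval₂ (aeval fun b => aeval p (g b) : MvPolynomial β ℚ →ₐ[ℚ] K).toRingHom
        (aeval p f) * dirDeriv p v f := by
    intro Q
    induction Q using Polynomial.induction_on' with
    | add a b ha hb =>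
      rw [Polynomial.eval₂_add, dirDeriv_add, ha, hb, Polynomial.derivative_add,
        Polynomial.eval₂_add, add_mul]
    | monomial n a =>
      have hpow : dirDeriv p v (f ^ n) = n * (aeval p f) ^ (n - 1) * dirDeriv p v f := by
        induction n with
        | zero => simpa using dirDeriv_C p v 1
        | succ n ih =>
          rw [pow_succ, dirDeriv_mul, ih, map_pow]
          rcases n with _ | n
          · simp
          · simp only [Nat.add_sub_cancel, Nat.cast_add, Nat.cast_one]; ring
      rw [Polynomial.eval₂_monomial, dirDeriv_mul, Polynomial.derivative_monomial,
        Polynomial.eval₂_monomial, hpow]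
      have := hc a
      simp only [AlgHom.toRingHom_eq_coe, RingHom.coe_coe] at this ⊢
      rw [this, hcomp, map_mul, map_natCast]
      ring
  have h2 := key P
  rw [h0] at h2
  have h3 : dirDeriv p v (0 : MvPolynomial ι ℚ) = 0 := by simp [dirDeriv]
  rw [h3] at h2
  exact (mul_eq_zero.mp h2.symm).resolve_left h1

theorem exists_hasStrictFDerivAt_aeval {ι : Type*} [Fintype ι] (f : MvPolynomial ι ℚ)
    (p : ι → ℝ) : ∃ L : (ι → ℝ) →L[ℝ] ℝ,
      HasStrictFDerivAt (fun q : ι → ℝ => aeval q f) L p ∧ ∀ v, L v = dirDeriv p v f := by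
  induction f using MvPolynomial.induction_on with
  | C a => exact ⟨0, by simpa using hasStrictFDerivAt_const _ _, fun v => by simp [dirDeriv_C]⟩
  | add a b ha hb =>
    obtain ⟨L, hL, h1⟩ := ha
    obtain ⟨L', hL', h1'⟩ := hb
    refine ⟨L + L', ?_, fun v => by simp [dirDeriv_add, h1, h1']⟩
    simp only [map_add]
    exact hL.add hL'
  | mul_X a i ha =>
    obtain ⟨L, hL, h1⟩ := ha
    have hX := (ContinuousLinearMap.proj (R := ℝ) (φ := fun _ : ι => ℝ) i).hasStrictFDerivAt
      (x := p)
    refine ⟨aeval p a • ContinuousLinearMap.proj i + p i • L, ?_, fun v => ?_⟩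
    · simp only [map_mul, aeval_X]
      exact hL.mul hX
    · simp [dirDeriv_mul, dirDeriv_X, h1]

end MvPolynomial

/-! ### Isolated points of fibres and transcendence degree -/

section

open Filter Topology AlgebraicIndependent

theorem AlgebraicIndependent.mem_matroid_closure_iff {R A : Type*} [CommRing R] [CommRing A]
    [Algebra R A] [FaithfulSMul R A] [IsDomain A] {s : Set A} {a : A} :
    a ∈ (matroid R A).closure s ↔ IsAlgebraic (Algebra.adjoin R s) a := by
  rw [matroid_closure_eq]; rfl

theorem AlgebraicIndependent.matroid_indep_range {ι R A : Type*} [CommRing R] [CommRing A]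
    [Algebra R A] [FaithfulSMul R A] [IsDomain A] {x : ι → A} (hx : AlgebraicIndependent R x) :
    (matroid R A).Indep (Set.range x) :=
  matroid_indep_iff.mpr (AlgebraicIndependent.coe_range hx)

theorem AlgebraicIndependent.eRk_range {ι R A : Type*} [CommRing R] [Nontrivial R] [CommRing A]
    [Algebra R A] [FaithfulSMul R A] [IsDomain A] {x : ι → A} (hx : AlgebraicIndependent R x) :
    (matroid R A).eRk (Set.range x) = ENat.card ι := by
  rw [(matroid_indep_range hx).eRk_eq_encard, ← Set.image_univ,
    hx.injective.encard_image, Set.encard_univ]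

namespace MvPolynomial

/-- If a generic real point is isolated in its fibre under finitely many polynomials, then its
coordinates are algebraic over the values of these polynomials. -/
theorem mem_closure_of_isolated_in_fibre {ι κ : Type*} [Finite ι] [Finite κ] {p : ι → ℝ}
    (hp : AlgebraicIndependent ℚ p) (f : κ → MvPolynomial ι ℚ)
    (h : ∀ᶠ q in 𝓝 p, (∀ k, aeval q (f k) = aeval p (f k)) → q = p) (i : ι) :
    p i ∈ (matroid ℚ ℝ).closure (Set.range fun k => aeval p (f k)) := by
  classical
  have := Fintype.ofFinite ι
  set M := matroid ℚ ℝ with hM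
  set F := Set.range fun k => aeval p (f k) with hF
  obtain ⟨B, hB⟩ := M.exists_isBasis F
  -- B' extends a transcendence basis B of the values of f to one of all coordinates, so it has
  -- exactly |ι| elements and can serve as a local coordinate system at p.
  obtain ⟨B', hB', hBB'⟩ := hB.indep.subset_isBasis_of_subset
    (hB.subset.trans (Set.subset_union_left (t := Set.range p)))
  have hindep : M.Indep (Set.range p) := matroid_indep_range hp
  have hcl : F ∪ Set.range p ⊆ M.closure (Set.range p) := by
    refine Set.union_subset ?_ (M.subset_closure _ (Set.subset_univ _))
    rintro _ ⟨k, rfl⟩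
    refine mem_matroid_closure_iff.mpr (isAlgebraic_algebraMap
      (⟨aeval p (f k), ?_⟩ : Algebra.adjoin ℚ (Set.range p)))
    rw [Algebra.adjoin_range_eq_range_aeval]
    exact ⟨_, rfl⟩
  have hcard : B'.encard = ENat.card ι := by
    rw [hB'.encard_eq_eRk]
    apply le_antisymm
    · exact (M.eRk_mono hcl).trans (by rw [M.eRk_closure_eq, hp.eRk_range])
    · rw [← hp.eRk_range]
      exact M.eRk_mono Set.subset_union_right
  have hfin : B'.Finite := by
    rw [← Set.encard_lt_top_iff, hcard]; simp
  have := hfin.fintype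
  by_contra hi
  have hmem : ∀ j, p j ∈ M.closure B' := fun j => by
    rw [hB'.closure_eq_closure]
    exact M.subset_closure (F ∪ Set.range p) (Set.subset_univ _) (Or.inr ⟨j, rfl⟩)
  -- If the values of f do not generate everything, some coordinate c of this system is free: it can
  -- be moved while the members of B stay fixed.
  obtain ⟨c, hc, hcB⟩ : ∃ c ∈ B', c ∉ B := by
    by_contra! hcon
    apply hi
    rw [← hB.closure_eq_closure, hBB'.antisymm hcon]
    exact hmem i
  have hg : ∀ b : B', ∃ g : MvPolynomial ι ℚ, aeval p g = (b : ℝ) := by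
    rintro ⟨b, hb⟩
    rcases hB'.subset hb with ⟨k, rfl⟩ | ⟨j, rfl⟩
    · exact ⟨_, rfl⟩
    · exact ⟨X j, by simp⟩
  choose g hg using hg
  choose L hL hL' using fun b => exists_hasStrictFDerivAt_aeval (g b) p
  let Φ : (ι → ℝ) → (B' → ℝ) := fun q b => aeval q (g b)
  have hΦ : HasStrictFDerivAt Φ (ContinuousLinearMap.pi L) p := hasStrictFDerivAt_pi.mpr hL
  -- A vector killed by the differential of all members of B' kills every coordinate, since the
  -- coordinates are algebraic over B'. The differential is thus invertible and Φ is open at p.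
  have hinj : Function.Injective (ContinuousLinearMap.pi L : (ι → ℝ) →L[ℝ] (B' → ℝ)) := by
    rw [injective_iff_map_eq_zero]
    intro v hv
    ext j
    rw [← dirDeriv_X p v j]
    refine dirDeriv_eq_zero_of_isAlgebraic hp v g (X j) ?_ fun b => ?_
    · have : (Set.range fun b => aeval p (g b)) = B' := by simp [hg]
      rw [this, aeval_X]
      exact mem_matroid_closure_iff.mp (hmem j)
    · rw [← hL']; exact congrFun hv b
  have hsurj : Function.Surjective (ContinuousLinearMap.pi L : (ι → ℝ) →L[ℝ] (B' → ℝ)) := by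
    have hdim : Module.finrank ℝ (ι → ℝ) = Module.finrank ℝ (B' → ℝ) := by
      simp only [Module.finrank_fintype_fun_eq_card]
      rw [Set.encard, ENat.card_eq_coe_fintype_card, ENat.card_eq_coe_fintype_card] at hcard
      exact_mod_cast hcard.symm
    exact (LinearMap.injective_iff_surjective_of_finrank_eq_finrank
      (f := (ContinuousLinearMap.pi L : (ι → ℝ) →L[ℝ] (B' → ℝ)).toLinearMap) hdim).mp hinj
  have hmap := hΦ.map_nhds_eq_of_surj (LinearMap.range_eq_top.mpr hsurj)
  have hroot : ∀ k, ∃ H : Polynomial ℝ, H ≠ 0 ∧ ∀ q : ι → ℝ,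
      (∀ b : B, aeval q (g ⟨b, hBB' b.2⟩) = aeval p (g ⟨b, hBB' b.2⟩)) →
        H.IsRoot (aeval q (f k)) := by
    intro k
    apply exists_polynomial_of_isAlgebraic hp
    have : (Set.range fun b : B => aeval p (g ⟨b, hBB' b.2⟩)) = B := by simp [hg]
    rw [this, ← mem_matroid_closure_iff, hB.closure_eq_closure]
    exact M.subset_closure F (Set.subset_univ _) ⟨k, rfl⟩
  choose H hH0 hH using hroot
  have hev : ∀ᶠ q in 𝓝 p, ∀ k, (H k).IsRoot (aeval q (f k)) → aeval q (f k) = aeval p (f k) := by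
    rw [eventually_all]
    intro k
    obtain ⟨L, hL, -⟩ := exists_hasStrictFDerivAt_aeval (f k) p
    have hfin : ({x | (H k).IsRoot x} \ {aeval p (f k)}).Finite :=
      ((H k).finite_setOfPred_isRoot (hH0 k)).subset Set.sdiff_subset
    have := hL.continuousAt.eventually (hfin.isClosed.isOpen_compl.mem_nhds (by simp))
    filter_upwards [this] with q hq hr
    by_contra hne
    exact hq ⟨hr, hne⟩
  -- With B fixed each f k has finitely many possible values, hence near p only the value f k (p);
  -- isolation then gives q = p. Moving c by a small ε ≠ 0 contradicts this.
  have hev2 : ∀ᶠ q in 𝓝 p, (∀ b : B', (b : ℝ) ≠ c → aeval q (g b) = (b : ℝ)) → q = p := by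
    filter_upwards [h, hev] with q h1 h2 h3
    refine h1 fun k => h2 k (hH k q fun b => ?_)
    rw [hg, h3]
    rintro hbc
    exact hcB (hbc ▸ b.2)
  have hε : Tendsto (fun ε : ℝ => Function.update (Φ p) ⟨c, hc⟩ (c + ε)) (𝓝 0) (𝓝 (Φ p)) := by
    have h1 : ContinuousAt (fun ε : ℝ => Function.update (Φ p) ⟨c, hc⟩ (c + ε)) 0 := by fun_prop
    have h2 : Function.update (Φ p) ⟨c, hc⟩ (c + 0) = Φ p := by
      rw [add_zero, Function.update_eq_self_iff]
      simp [Φ, hg]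
    rw [ContinuousAt, h2] at h1
    exact h1
  rw [← hmap] at hε
  have hev3 : ∀ᶠ ε in 𝓝[≠] (0 : ℝ), Function.update (Φ p) ⟨c, hc⟩ (c + ε) ∈ Φ '' _ :=
    (hε.mono_left nhdsWithin_le_nhds).eventually (image_mem_map hev2)
  obtain ⟨ε, ⟨q, hq, hqε⟩, hε0⟩ := (hev3.and self_mem_nhdsWithin).exists
  have hqp : q = p := hq fun b hb => by
    have := congrFun hqε b
    rw [Function.update_of_ne (fun h => hb (congrArg Subtype.val h))] at this
    rw [← hg b]; exact this
  have := congrFun hqε ⟨c, hc⟩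
  rw [hqp, Function.update_self] at this
  simp only [Φ, hg] at this
  exact hε0 (by simpa using this)

end MvPolynomial

end

/-! ### Rigid frameworks have edge lengths of rank at least 2|V| - 3 -/

section

open Filter Topology AlgebraicIndependent

namespace PlaneFramework

/-- The set of squared edge lengths of a realisation. -/
def edgeLengths {V K : Type*} [CommRing K] (G : SimpleGraph V) (p : V → Fin 2 → K) : Set K :=
  Set.range fun e : {e : V × V // G.Adj e.1 e.2} => d (p e.1.1 - p e.1.2)

/-- The squared distance of two vertices as a polynomial in the coordinates. -/
noncomputable def lengthPoly {V : Type*} (u v : V) : MvPolynomial (V × Fin 2) ℚ :=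
  d fun i => MvPolynomial.X (u, i) - MvPolynomial.X (v, i)

theorem aeval_lengthPoly {V K : Type*} [CommRing K] [Algebra ℚ K] (q : V × Fin 2 → K) (u v : V) :
    MvPolynomial.aeval q (lengthPoly u v) = d (Function.curry q u - Function.curry q v) := by
  simp [lengthPoly, d, Function.curry]

theorem aeval_ne_zero_of_generic {ι K : Type*} [CommRing K] [Algebra ℚ K] {p : ι → K}
    (hp : AlgebraicIndependent ℚ p) {F : MvPolynomial ι ℚ} (r : ι → ℚ)
    (hr : MvPolynomial.eval r F ≠ 0) : MvPolynomial.aeval p F ≠ 0 := by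
  intro h
  have : F = 0 := hp (by simpa using h)
  simp [this] at hr

theorem det_ne_zero_of_generic {V K : Type*} [CommRing K] [Algebra ℚ K] {p : V → Fin 2 → K}
    (hp : IsGeneric p) {a b c : V} (hab : a ≠ b) (hac : a ≠ c) (hbc : b ≠ c) :
    (p b 0 - p a 0) * (p c 1 - p a 1) - (p b 1 - p a 1) * (p c 0 - p a 0) ≠ 0 := by
  classical
  have := aeval_ne_zero_of_generic hp
    (F := (.X (b, 0) - .X (a, 0)) * (.X (c, 1) - .X (a, 1)) -
      (.X (b, 1) - .X (a, 1)) * (.X (c, 0) - .X (a, 0)))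
    (fun x => if x = (b, 0) then 1 else if x = (c, 1) then 1 else 0)
    (by simp [hab, hac, hbc, hbc.symm])
  simpa using this

/-- A rigid generic real framework is isolated among the equivalent frameworks in which one vertex
and one further coordinate are pinned. -/
theorem IsRigidFramework.eventually_eq {V : Type*} [Finite V] {G : SimpleGraph V}
    {p : V → Fin 2 → ℝ} (hp : IsGeneric p) (hG : IsRigidFramework G p) {a b : V} (hab : a ≠ b) :
    ∀ᶠ q : V × Fin 2 → ℝ in 𝓝 (Function.uncurry p),
      Equivalent G p (Function.curry q) → q (a, 0) = p a 0 → q (a, 1) = p a 1 →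
        q (b, 0) = p b 0 → q = Function.uncurry p := by
  obtain ⟨ε, hε, hG⟩ := hG
  have h1 : ∀ᶠ q : V × Fin 2 → ℝ in 𝓝 (Function.uncurry p),
      ∀ v, d (p v - Function.curry q v) < ε := by
    rw [eventually_all]
    intro v
    have hc : Continuous fun q : V × Fin 2 → ℝ => d (p v - Function.curry q v) := by
      simp only [d, Function.curry, Pi.sub_apply]; fun_prop
    exact hc.continuousAt.eventually_lt continuousAt_const
      (by simpa [d, Function.curry, Function.uncurry] using hε)
  -- Excludes the mirror image of b in the horizontal line through a, the only other position with
  -- the pinned coordinate and the right distance from a.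
  have h2 : ∀ᶠ q : V × Fin 2 → ℝ in 𝓝 (Function.uncurry p), q (b, 1) + p b 1 - 2 * p a 1 ≠ 0 := by
    have hc : Continuous fun q : V × Fin 2 → ℝ => q (b, 1) + p b 1 - 2 * p a 1 := by fun_prop
    refine hc.continuousAt.eventually_ne ?_
    have := hp.injective.ne (a₁ := (a, 1)) (a₂ := (b, 1)) (by simpa using hab)
    intro h
    apply this
    simp only [Function.uncurry] at h
    linarith
  -- This is the determinant of the linear system e1, e2 for q v - p v obtained below; at q = p it
  -- is twice the determinant of the triangle a, b, v.
  have h3 : ∀ᶠ q : V × Fin 2 → ℝ in 𝓝 (Function.uncurry p), ∀ v, v ≠ a → v ≠ b →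
      (p b 0 - p a 0) * (q (v, 1) + p v 1 - 2 * p a 1) -
        (p b 1 - p a 1) * (q (v, 0) + p v 0 - 2 * p a 0) ≠ 0 := by
    rw [eventually_all]
    intro v
    by_cases hva : v = a
    · simp [hva]
    by_cases hvb : v = b
    · simp [hvb]
    have hc : Continuous fun q : V × Fin 2 → ℝ =>
      (p b 0 - p a 0) * (q (v, 1) + p v 1 - 2 * p a 1) -
        (p b 1 - p a 1) * (q (v, 0) + p v 0 - 2 * p a 0) := by fun_prop
    have hne := det_ne_zero_of_generic hp hab (Ne.symm hva) (Ne.symm hvb)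
    filter_upwards [hc.continuousAt.eventually_ne (y := 0) fun h => hne (by
      simp only [Function.uncurry] at h; linarith)] with q hq _ _
    exact hq
  filter_upwards [h1, h2, h3] with q h1 h2 h3 he ha0 ha1 hb0
  have hcong := hG _ he h1
  have hb1 : q (b, 1) = p b 1 := by
    have := hcong b a
    simp only [d, Function.curry, Pi.sub_apply, ha0, ha1, hb0] at this
    have h : (q (b, 1) + p b 1 - 2 * p a 1) * (q (b, 1) - p b 1) = 0 := by linarith
    linarith [(mul_eq_zero.mp h).resolve_left h2]
  have hv : ∀ v, q (v, 0) = p v 0 ∧ q (v, 1) = p v 1 := by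
    intro v
    by_cases hva : v = a
    · exact hva ▸ ⟨ha0, ha1⟩
    by_cases hvb : v = b
    · exact hvb ▸ ⟨hb0, hb1⟩
    have h4 := hcong v a
    have h5 := hcong v b
    simp only [d, Function.curry, Pi.sub_apply, ha0, ha1, hb0, hb1] at h4 h5
    have h6 := h3 v hva hvb
    have e1 : (q (v, 0) - p v 0) * (p b 0 - p a 0) + (q (v, 1) - p v 1) * (p b 1 - p a 1) = 0 := by
      linarith
    have e2 : (q (v, 0) - p v 0) * (q (v, 0) + p v 0 - 2 * p a 0) +
      (q (v, 1) - p v 1) * (q (v, 1) + p v 1 - 2 * p a 1) = 0 := by linarith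
    constructor
    · refine sub_eq_zero.mp ((mul_eq_zero.mp (?_ : _ * _ = (0 : ℝ))).resolve_left h6)
      linear_combination (q (v, 1) + p v 1 - 2 * p a 1) * e1 - (p b 1 - p a 1) * e2
    · refine sub_eq_zero.mp ((mul_eq_zero.mp (?_ : _ * _ = (0 : ℝ))).resolve_left h6)
      linear_combination (p b 0 - p a 0) * e2 - (q (v, 0) + p v 0 - 2 * p a 0) * e1
  ext ⟨v, i⟩
  fin_cases i
  · exact (hv v).1
  · exact (hv v).2

/-- The squared edge lengths of a rigid generic real framework have transcendence degree at least
`2|V| - 3`. -/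
theorem IsRigidFramework.le_eRk_edgeLengths {V : Type*} [Finite V] {G : SimpleGraph V}
    {p : V → Fin 2 → ℝ} (hp : IsGeneric p) (hG : IsRigidFramework G p) {a b : V} (hab : a ≠ b) :
    (2 * Nat.card V : ℕ∞) ≤ (matroid ℚ ℝ).eRk (edgeLengths G p) + 3 := by
  -- The three pinned coordinates remove the motions and account for the summand 3.
  let f : {e : V × V // G.Adj e.1 e.2} ⊕ Fin 3 → MvPolynomial (V × Fin 2) ℚ :=
    Sum.elim (fun e => lengthPoly e.1.1 e.1.2) ![.X (a, 0), .X (a, 1), .X (b, 0)]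
  have hp' : AlgebraicIndependent ℚ (Function.uncurry p) := hp
  have hcl := MvPolynomial.mem_closure_of_isolated_in_fibre hp' f (by
    filter_upwards [hG.eventually_eq hp hab] with q hq h
    refine hq (fun u v huv => ?_) ?_ ?_ ?_
    · have := h (Sum.inl ⟨(u, v), huv⟩)
      simp only [f, Sum.elim_inl, aeval_lengthPoly] at this
      exact this.symm
    · simpa [f] using h (Sum.inr 0)
    · simpa [f] using h (Sum.inr 1)
    · simpa [f] using h (Sum.inr 2))
  have hr : (Set.range fun k => MvPolynomial.aeval (Function.uncurry p) (f k)) ⊆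
      edgeLengths G p ∪ {p a 0, p a 1, p b 0} := by
    rintro _ ⟨k | k, rfl⟩
    · left
      simp only [f, Sum.elim_inl, aeval_lengthPoly]
      exact ⟨k, rfl⟩
    · right
      fin_cases k <;> simp [f]
  calc (2 * Nat.card V : ℕ∞) = ENat.card (V × Fin 2) := by
        rw [ENat.card_eq_coe_natCard, Nat.card_prod]; simp [mul_comm]
    _ = (matroid ℚ ℝ).eRk (Set.range (Function.uncurry p)) := hp'.eRk_range.symm
    _ ≤ (matroid ℚ ℝ).eRk ((matroid ℚ ℝ).closure (edgeLengths G p ∪ {p a 0, p a 1, p b 0})) := by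
        apply Matroid.eRk_mono
        rintro _ ⟨x, rfl⟩
        exact (matroid ℚ ℝ).closure_subset_closure hr (hcl x)
    _ = (matroid ℚ ℝ).eRk (edgeLengths G p ∪ {p a 0, p a 1, p b 0}) := Matroid.eRk_closure_eq _ _
    _ ≤ _ := Matroid.eRk_union_le_eRk_add_encard _ _ _
    _ ≤ _ := by
        gcongr
        refine (Set.encard_insert_le _ _).trans ?_
        refine (add_le_add_left (Set.encard_insert_le _ _) 1).trans ?_
        rw [Set.encard_singleton]; norm_num

/-- The complex framework given by a real one. -/
noncomputable def complexify {V : Type*} (p : V → Fin 2 → ℝ) : V → Fin 2 → ℂ := fun v i => p v i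

theorem d_complexify {V : Type*} (p : V → Fin 2 → ℝ) (u v : V) :
    d (complexify p u - complexify p v) = ((d (p u - p v) : ℝ) : ℂ) := by
  simp [d, complexify]

theorem isGeneric_complexify {V : Type*} {p : V → Fin 2 → ℝ} (hp : IsGeneric p) :
    IsGeneric (complexify p) :=
  AlgebraicIndependent.map' (f := IsScalarTower.toAlgHom ℚ ℝ ℂ) hp Complex.ofReal_injective

/-- An independent subset of s stays independent under an injective algebra map; this transfers
ranks from ℝ to ℂ. -/
theorem eRk_le_eRk_image {R A B : Type*} [CommRing R] [CommRing A] [CommRing B]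
    [Algebra R A] [Algebra R B] [FaithfulSMul R A] [FaithfulSMul R B] [IsDomain A] [IsDomain B]
    (f : A →ₐ[R] B) (hf : Function.Injective f) (s : Set A) :
    (matroid R A).eRk s ≤ (matroid R B).eRk (f '' s) := by
  obtain ⟨I, hIs, hI, hcard⟩ := Matroid.le_eRk_iff.mp (le_refl ((matroid R A).eRk s))
  have := (AlgebraicIndependent.map' (f := f) (matroid_indep_iff.mp hI) hf)
  have h2 := matroid_indep_range this
  have h3 : Set.range (f ∘ fun i : I => id (i : A)) = f '' I := by
    ext; simp
  rw [h3] at h2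
  exact Matroid.le_eRk_iff.mpr ⟨f '' I, Set.image_mono hIs, h2, by rw [hf.encard_image, hcard]⟩

theorem le_eRk_edgeLengths_complexify {V : Type*} [Finite V] {G : SimpleGraph V}
    {p : V → Fin 2 → ℝ} (hp : IsGeneric p) (hG : IsRigidFramework G p) {a b : V} (hab : a ≠ b) :
    (2 * Nat.card V : ℕ∞) ≤ (matroid ℚ ℂ).eRk (edgeLengths G (complexify p)) + 3 := by
  have h := eRk_le_eRk_image (IsScalarTower.toAlgHom ℚ ℝ ℂ) Complex.ofReal_injective
    (edgeLengths G p)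
  have h2 : (IsScalarTower.toAlgHom ℚ ℝ ℂ) '' (edgeLengths G p) =
      edgeLengths G (complexify p) := by
    rw [edgeLengths, edgeLengths, ← Set.range_comp]
    congr 1
    ext e
    exact (d_complexify p _ _).symm
  rw [h2] at h
  exact (hG.le_eRk_edgeLengths hp hab).trans (by gcongr)

end PlaneFramework

end

/-! ### Upper bounds for the rank of all squared distances -/

section

open AlgebraicIndependent

namespace PlaneFramework

/-- The set of all elements of `K` that are algebraic over `ℚ(s)`. -/
noncomputable def algClosure {K : Type*} [Field K] [Algebra ℚ K] (s : Set K) :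
    IntermediateField ℚ K :=
  ((Subalgebra.algebraicClosure (Algebra.adjoin ℚ s) K).restrictScalars ℚ).toIntermediateField
    fun _ hx => IsAlgebraic.inv hx

/-- The flats of the algebraic matroid are fields, so rank counting can be mixed with field
arithmetic. -/
theorem coe_algClosure {K : Type*} [Field K] [Algebra ℚ K] (s : Set K) :
    (algClosure s : Set K) = (matroid ℚ K).closure s :=
  (matroid_closure_eq).symm

theorem mem_algClosure {K : Type*} [Field K] [Algebra ℚ K] {s : Set K} {x : K} :
    x ∈ algClosure s ↔ x ∈ (matroid ℚ K).closure s := by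
  rw [← coe_algClosure]; rfl

theorem subset_algClosure {K : Type*} [Field K] [Algebra ℚ K] (s : Set K) :
    s ⊆ algClosure s := by
  rw [coe_algClosure]; exact Matroid.subset_closure _ _ (Set.subset_univ _)

theorem algClosure_mono {K : Type*} [Field K] [Algebra ℚ K] {s t : Set K} (h : s ⊆ t) :
    algClosure s ≤ algClosure t := by
  rw [← SetLike.coe_subset_coe, coe_algClosure, coe_algClosure]
  exact Matroid.closure_subset_closure _ h

theorem eRk_le_of_subset_algClosure {K : Type*} [Field K] [Algebra ℚ K] {s t : Set K}
    (h : s ⊆ algClosure t) : (matroid ℚ K).eRk s ≤ (matroid ℚ K).eRk t := by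
  rw [coe_algClosure] at h
  exact ((matroid ℚ K).eRk_mono h).trans (Matroid.eRk_closure_eq _ _).le

theorem mem_algClosure_of_isAlgebraic {K : Type*} [Field K] [Algebra ℚ K] {s : Set K} {x : K}
    (h : IsAlgebraic (algClosure s) x) : x ∈ algClosure s := by
  rw [mem_algClosure, ← Matroid.closure_closure, ← coe_algClosure s, mem_matroid_closure_iff]
  have h2 : Algebra.adjoin ℚ (algClosure s : Set K) = (algClosure s).toSubalgebra :=
    Algebra.adjoin_eq _
  rw [h2]
  exact h

/-- A set spanned by a family with at most as many members as its rank: the family is independent. -/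
theorem algebraicIndependent_of_card_le_eRk {ι K : Type*} [Finite ι] [Field K] [Algebra ℚ K]
    {x : ι → K} (h : ENat.card ι ≤ (matroid ℚ K).eRk (Set.range x)) :
    AlgebraicIndependent ℚ x := by
  have h1 : (Set.range x).encard ≤ ENat.card ι := by
    rw [← Set.image_univ, ← Set.encard_univ]; exact Set.encard_image_le _ _
  have h2 : (Set.range x).encard ≤ (matroid ℚ K).eRk (Set.range x) := h1.trans h
  have h3 : (matroid ℚ K).Indep (Set.range x) :=
    Matroid.IsRkFinite.indep_of_encard_le_eRk (Matroid.isRkFinite_of_finite _ (Set.finite_range x)) h2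
  have hinj : Function.Injective x := by
    have h4 : (x '' Set.univ).encard = (Set.univ : Set ι).encard := by
      rw [Set.image_univ, Set.encard_univ]
      exact h1.antisymm (h.trans (Matroid.eRk_le_encard _ _))
    exact Set.injOn_univ.mp (Set.finite_univ.injOn_of_encard_image_eq h4)
  exact (algebraicIndependent_subtype_range hinj).mp (matroid_indep_iff.mp h3)

/-- All squared distances of a realisation with isotropic coordinates `Z`, `W`. -/
def isoLengths {V : Type*} (Z W : V → ℂ) : Set ℂ :=
  Set.range fun e : V × V => (Z e.1 - Z e.2) * (W e.1 - W e.2)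

theorem isoLengths_comm {V : Type*} (Z W : V → ℂ) : isoLengths Z W = isoLengths W Z := by
  simp only [isoLengths, mul_comm]

/-- Invariance under direct motions: it allows vertices to be normalised before coordinates are
counted. -/
theorem isoLengths_affine {V : Type*} (Z W : V → ℂ) {c : ℂ} (hc : c ≠ 0) (s t : ℂ) :
    isoLengths (fun v => c * (Z v - s)) (fun v => c⁻¹ * (W v - t)) = isoLengths Z W := by
  unfold isoLengths
  congr 1
  ext e
  field_simp
  ring

/-- R consists of the two coordinates of each vertex outside S; the vertices in S cost only what T
costs. -/
theorem isoLengths_subset {V : Type*} [Finite V] (Z W : V → ℂ) (S : Finset V) (T : Set ℂ)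
    (hT : ∀ v ∈ S, Z v ∈ algClosure T ∧ W v ∈ algClosure T) :
    ∃ R : Set ℂ, R.encard + 2 * S.card ≤ 2 * Nat.card V ∧ isoLengths Z W ⊆ algClosure (T ∪ R) := by
  classical
  have := Fintype.ofFinite V
  refine ⟨Z '' (Sᶜ : Finset V) ∪ W '' (Sᶜ : Finset V), ?_, ?_⟩
  · have h1 := Set.encard_union_le (Z '' (Sᶜ : Finset V)) (W '' (Sᶜ : Finset V))
    have h2 := Set.encard_image_le Z (Sᶜ : Finset V)
    have h3 := Set.encard_image_le W (Sᶜ : Finset V)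
    rw [Set.encard_coe_eq_coe_finsetCard] at h2 h3
    have h4 := S.card_add_card_compl
    rw [← Nat.card_eq_fintype_card] at h4
    calc _ ≤ ((Sᶜ.card : ℕ∞) + Sᶜ.card) + 2 * S.card := by
            gcongr; exact h1.trans (add_le_add h2 h3)
      _ = _ := by rw [← h4]; push_cast; ring
  · have hmem : ∀ v, Z v ∈ algClosure (T ∪ (Z '' (Sᶜ : Finset V) ∪ W '' (Sᶜ : Finset V))) ∧
        W v ∈ algClosure (T ∪ (Z '' (Sᶜ : Finset V) ∪ W '' (Sᶜ : Finset V))) := by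
      intro v
      by_cases hv : v ∈ S
      · exact ⟨algClosure_mono Set.subset_union_left (hT v hv).1,
          algClosure_mono Set.subset_union_left (hT v hv).2⟩
      · have hv' : v ∈ ((Sᶜ : Finset V) : Set V) := by simpa using hv
        exact ⟨subset_algClosure _ (Or.inr (Or.inl ⟨v, hv', rfl⟩)),
          subset_algClosure _ (Or.inr (Or.inr ⟨v, hv', rfl⟩))⟩
    rintro _ ⟨e, rfl⟩
    exact mul_mem (sub_mem (hmem _).1 (hmem _).1) (sub_mem (hmem _).2 (hmem _).2)

/-- A realisation with two vertices at isotropic position has at most `2|V| - 4` independent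
squared distances. -/
theorem eRk_isoLengths_degenerate {V : Type*} [Finite V] (Z W : V → ℂ) {a b : V} (hab : a ≠ b)
    (h : (Z b - Z a) * (W b - W a) = 0) :
    (matroid ℚ ℂ).eRk (isoLengths Z W) + 4 ≤ 2 * Nat.card V := by
  classical
  have key : ∀ Z W : V → ℂ, W b = W a →
      (matroid ℚ ℂ).eRk (isoLengths Z W) + 4 ≤ 2 * Nat.card V := by
    intro Z W hW
    -- After moving a to the origin, b has second coordinate 0, and its first can be scaled to 0 or
    -- 1. Both vertices then have rational coordinates, which saves four parameters.
    obtain ⟨c, hc, hcb⟩ : ∃ c : ℂ, c ≠ 0 ∧ (c * (Z b - Z a) = 0 ∨ c * (Z b - Z a) = 1) := by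
      by_cases hz : Z b - Z a = 0
      · exact ⟨1, one_ne_zero, by simp [hz]⟩
      · exact ⟨(Z b - Z a)⁻¹, inv_ne_zero hz, Or.inr (inv_mul_cancel₀ hz)⟩
    obtain ⟨R, hR, hsub⟩ := isoLengths_subset (fun v => c * (Z v - Z a))
      (fun v => c⁻¹ * (W v - W a)) {a, b} ∅ (by
        intro v hv
        rcases Finset.mem_insert.mp hv with rfl | hv
        · simp
        · obtain rfl := Finset.mem_singleton.mp hv
          rcases hcb with hcb | hcb <;> simp [hcb, hW])
    rw [isoLengths_affine Z W hc, Set.empty_union] at hsub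
    rw [Finset.card_pair hab] at hR
    refine le_trans ?_ hR
    have := (eRk_le_of_subset_algClosure hsub).trans (Matroid.eRk_le_encard _ _)
    norm_num
    gcongr
  rcases mul_eq_zero.mp h with h | h
  · rw [isoLengths_comm]; exact key W Z (sub_eq_zero.mp h)
  · exact key Z W (sub_eq_zero.mp h)

/-- A realisation has at most `2|V| - 3` independent squared distances. -/
theorem eRk_isoLengths_le {V : Type*} [Finite V] (Z W : V → ℂ) {a b : V} (hab : a ≠ b) :
    (matroid ℚ ℂ).eRk (isoLengths Z W) + 3 ≤ 2 * Nat.card V := by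
  classical
  by_cases h : (Z b - Z a) * (W b - W a) = 0
  · refine le_trans ?_ (eRk_isoLengths_degenerate Z W hab h)
    gcongr; norm_num
  have hz := left_ne_zero_of_mul h
  -- With a at the origin and the Z-coordinate of b equal to 1, the pair a, b contributes a single
  -- parameter instead of four.
  obtain ⟨R, hR, hsub⟩ := isoLengths_subset (fun v => (Z b - Z a)⁻¹ * (Z v - Z a))
      (fun v => (Z b - Z a)⁻¹⁻¹ * (W v - W a)) {a, b} {(Z b - Z a)⁻¹⁻¹ * (W b - W a)} (by
        intro v hv
        rcases Finset.mem_insert.mp hv with rfl | hv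
        · simp
        · obtain rfl := Finset.mem_singleton.mp hv
          exact ⟨by simp [hz], subset_algClosure _ rfl⟩)
  rw [isoLengths_affine Z W (inv_ne_zero hz)] at hsub
  rw [Finset.card_pair hab] at hR
  have h1 := (eRk_le_of_subset_algClosure hsub).trans
    (Matroid.eRk_union_le_encard_add_eRk _ _ _)
  rw [Set.encard_singleton] at h1
  have h2 := h1.trans (add_le_add_right (Matroid.eRk_le_encard _ R) _)
  calc _ ≤ (1 + R.encard) + 3 := by gcongr
    _ = R.encard + 2 * (2 : ℕ) := by push_cast; ring
    _ ≤ _ := hR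

/-- In normal form the squared distances are algebraic over the coordinates of a triangle and those
of the other vertices. -/
theorem isoLengths_subset_of_normal {V : Type*} [Finite V] (Z W : V → ℂ) {u : Fin 3 → V}
    (hu : Function.Injective u) (hZ0 : Z (u 0) = 0) (hW0 : W (u 0) = 0) (hZ1 : Z (u 1) = 1) :
    ∃ R : Set ℂ, R.encard + 6 ≤ 2 * Nat.card V ∧
      isoLengths Z W ⊆ algClosure ({W (u 1), Z (u 2), W (u 2)} ∪ R) := by
  classical
  obtain ⟨R, hR, hsub⟩ := isoLengths_subset Z W (Finset.univ.map ⟨u, hu⟩)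
    {W (u 1), Z (u 2), W (u 2)} (by
      intro v hv
      obtain ⟨i, -, rfl⟩ := Finset.mem_map.mp hv
      fin_cases i
      · simp [hZ0, hW0]
      · exact ⟨by simp [hZ1], subset_algClosure _ (by simp)⟩
      · exact ⟨subset_algClosure _ (by simp), subset_algClosure _ (by simp)⟩)
  refine ⟨R, ?_, hsub⟩
  rw [Finset.card_map, Finset.card_univ, Fintype.card_fin] at hR
  norm_num at hR
  exact hR

end PlaneFramework

end

/-! ### Counting the direct motions that fit three bars -/

section

open Polynomial

namespace PlaneFramework

/-- The direct motions `(Z, W) ↦ (λ Z + s, λ⁻¹ W + t)`, given by `(λ, s, t)`, for which the three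
points with isotropic coordinates `(z i, w i)` are moved to squared distance `l i` from the points
`(a i, b i)`. -/
def motions (a b z w l : Fin 3 → ℂ) : Set (ℂ × ℂ × ℂ) :=
  {x | x.1 ≠ 0 ∧ ∀ i, (a i - (x.1 * z i + x.2.1)) * (b i - (x.1⁻¹ * w i + x.2.2)) = l i}

section Elimination

variable {R : Type*} [CommRing R]

/-- Origin of the elimination: write X for λ, α and β for `elimAlpha` and `elimBeta`. With all index
0 points at the origin, the first bar says s t = l₀. Multiplied by λ, bar i of squared length l₀ + m
i becomes s β + (λ t) α = m i λ - α β, whose right side is `elimRho`. Cramer's rule for i = 1, 2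
gives s = `elimS` / `elimDet` and λ t = `elimT` / `elimDet`, and s t = l₀ becomes `elimNum` = l₀
`elimDen`. -/
noncomputable def elimAlpha (a z : Fin 3 → R) (i : Fin 3) : R[X] := C (z i) * X - C (a i)

noncomputable def elimBeta (b w : Fin 3 → R) (i : Fin 3) : R[X] := C (w i) - C (b i) * X

noncomputable def elimRho (a b z w m : Fin 3 → R) (i : Fin 3) : R[X] :=
  C (m i) * X - elimAlpha a z i * elimBeta b w i

/-- The determinant of the linear system for the translation part of a motion. -/
noncomputable def elimDet (a b z w : Fin 3 → R) : R[X] :=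
  elimBeta b w 1 * elimAlpha a z 2 - elimBeta b w 2 * elimAlpha a z 1

noncomputable def elimS (a b z w m : Fin 3 → R) : R[X] :=
  elimRho a b z w m 1 * elimAlpha a z 2 - elimRho a b z w m 2 * elimAlpha a z 1

noncomputable def elimT (a b z w m : Fin 3 → R) : R[X] :=
  elimBeta b w 1 * elimRho a b z w m 2 - elimBeta b w 2 * elimRho a b z w m 1

/-- The numerator and denominator of `l 0` as a rational function of `λ`. -/
noncomputable def elimNum (a b z w m : Fin 3 → R) : R[X] := elimS a b z w m * elimT a b z w m

noncomputable def elimDen (a b z w : Fin 3 → R) : R[X] := X * elimDet a b z w ^ 2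

end Elimination

/-- Compatibility with coefficient maps lets these polynomials be read over the field generated
algebraically by the data, so that their roots lie in that field. -/
theorem map_elimDet {R S : Type*} [CommRing R] [CommRing S] (f : R →+* S) (a b z w : Fin 3 → R) :
    (elimDet a b z w).map f = elimDet (f ∘ a) (f ∘ b) (f ∘ z) (f ∘ w) := by
  simp [elimDet, elimAlpha, elimBeta]

theorem map_elimNum {R S : Type*} [CommRing R] [CommRing S] (f : R →+* S)
    (a b z w m : Fin 3 → R) :
    (elimNum a b z w m).map f = elimNum (f ∘ a) (f ∘ b) (f ∘ z) (f ∘ w) (f ∘ m) := by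
  simp [elimNum, elimS, elimT, elimRho, elimAlpha, elimBeta]

theorem map_elimDen {R S : Type*} [CommRing R] [CommRing S] (f : R →+* S) (a b z w : Fin 3 → R) :
    (elimDen a b z w).map f = elimDen (f ∘ a) (f ∘ b) (f ∘ z) (f ∘ w) := by
  simp [elimDen, map_elimDet]

/-- The denominator has the factor X, so this value decides whether λ = 0 is a spurious root. -/
theorem elimNum_eval_zero {R : Type*} [CommRing R] (a b z w m : Fin 3 → R) :
    (elimNum a b z w m).eval 0 =
      (a 1 * a 2 * (w 2 - w 1)) * (w 1 * w 2 * (a 2 - a 1)) := by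
  simp [elimNum, elimS, elimT, elimRho, elimAlpha, elimBeta]
  ring

theorem elimDet_eval_zero {R : Type*} [CommRing R] (a b z w : Fin 3 → R) :
    (elimDet a b z w).eval 0 = w 2 * a 1 - w 1 * a 2 := by
  simp [elimDet, elimAlpha, elimBeta]
  ring

section Degrees

variable {R : Type*} [CommRing R] (a b z w m : Fin 3 → R) (i : Fin 3)

theorem natDegree_elimAlpha_le : (elimAlpha a z i).natDegree ≤ 1 := by
  unfold elimAlpha; compute_degree

theorem natDegree_elimBeta_le : (elimBeta b w i).natDegree ≤ 1 := by
  unfold elimBeta; compute_degree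

theorem coeff_elimAlpha : (elimAlpha a z i).coeff 1 = z i := by
  simp [elimAlpha, coeff_C]

theorem coeff_elimBeta : (elimBeta b w i).coeff 1 = -b i := by
  simp [elimBeta, coeff_C]

theorem natDegree_elimRho_le : (elimRho a b z w m i).natDegree ≤ 2 := by
  refine natDegree_sub_le_of_le (m := 2) (n := 2) (by compute_degree!) ?_
  exact natDegree_mul_le_of_le (natDegree_elimAlpha_le a z i) (natDegree_elimBeta_le b w i)

theorem coeff_elimRho : (elimRho a b z w m i).coeff 2 = z i * b i := by
  rw [elimRho, coeff_sub, coeff_mul_add_eq_of_natDegree_le (df := 1) (dg := 1) (natDegree_elimAlpha_le a z i)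
    (natDegree_elimBeta_le b w i), coeff_elimAlpha, coeff_elimBeta, coeff_C_mul,
    coeff_X_of_ne_one (by norm_num)]
  ring

theorem natDegree_elimDet_le : (elimDet a b z w).natDegree ≤ 2 :=
  natDegree_sub_le_of_le
    (natDegree_mul_le_of_le (natDegree_elimBeta_le b w 1) (natDegree_elimAlpha_le a z 2))
    (natDegree_mul_le_of_le (natDegree_elimBeta_le b w 2) (natDegree_elimAlpha_le a z 1))

theorem natDegree_elimS_le : (elimS a b z w m).natDegree ≤ 3 :=
  natDegree_sub_le_of_le
    (natDegree_mul_le_of_le (natDegree_elimRho_le a b z w m 1) (natDegree_elimAlpha_le a z 2))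
    (natDegree_mul_le_of_le (natDegree_elimRho_le a b z w m 2) (natDegree_elimAlpha_le a z 1))

theorem natDegree_elimT_le : (elimT a b z w m).natDegree ≤ 3 :=
  natDegree_sub_le_of_le
    (natDegree_mul_le_of_le (natDegree_elimBeta_le b w 1) (natDegree_elimRho_le a b z w m 2))
    (natDegree_mul_le_of_le (natDegree_elimBeta_le b w 2) (natDegree_elimRho_le a b z w m 1))

theorem coeff_elimS : (elimS a b z w m).coeff 3 = z 1 * z 2 * (b 1 - b 2) := by
  rw [elimS, coeff_sub, coeff_mul_add_eq_of_natDegree_le (df := 2) (dg := 1) (natDegree_elimRho_le a b z w m 1)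
    (natDegree_elimAlpha_le a z 2), coeff_mul_add_eq_of_natDegree_le (df := 2) (dg := 1) (natDegree_elimRho_le a b z w m 2)
    (natDegree_elimAlpha_le a z 1)]
  simp only [coeff_elimRho, coeff_elimAlpha]
  ring

theorem coeff_elimT : (elimT a b z w m).coeff 3 = b 1 * b 2 * (z 1 - z 2) := by
  rw [elimT, coeff_sub,
    coeff_mul_add_eq_of_natDegree_le (df := 1) (dg := 2) (natDegree_elimBeta_le b w 1) (natDegree_elimRho_le a b z w m 2),
    coeff_mul_add_eq_of_natDegree_le (df := 1) (dg := 2) (natDegree_elimBeta_le b w 2) (natDegree_elimRho_le a b z w m 1)]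
  simp only [coeff_elimRho, coeff_elimBeta]
  ring

theorem natDegree_elimDen_le : (elimDen a b z w).natDegree ≤ 5 := by
  refine (natDegree_mul_le_of_le natDegree_X_le
    (natDegree_pow_le_of_le 2 (natDegree_elimDet_le a b z w))).trans (by norm_num)

/-- The two factors of the numerator have degree at most 3 and the denominator has degree at most 5,
so the coefficient of degree 6 is the product of the cubic coefficients, whatever l is. -/
theorem natDegree_elim (l : R)
    (h : (z 1 * z 2 * (b 1 - b 2)) * (b 1 * b 2 * (z 1 - z 2)) ≠ 0) :
    (elimNum a b z w m - C l * elimDen a b z w).natDegree = 6 := by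
  apply natDegree_eq_of_le_of_coeff_ne_zero
  · refine natDegree_sub_le_of_le (m := 6) (n := 6)
      (natDegree_mul_le_of_le (natDegree_elimS_le a b z w m) (natDegree_elimT_le a b z w m)) ?_
    exact (natDegree_C_mul_le _ _).trans ((natDegree_elimDen_le a b z w).trans (by norm_num))
  · rw [elimNum, coeff_sub, coeff_mul_add_eq_of_natDegree_le (df := 3) (dg := 3) (natDegree_elimS_le a b z w m)
      (natDegree_elimT_le a b z w m), coeff_C_mul, coeff_elimS, coeff_elimT,
      coeff_eq_zero_of_natDegree_lt (p := elimDen a b z w)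
        ((natDegree_elimDen_le a b z w).trans_lt (by norm_num)), mul_zero, sub_zero]
    exact h

end Degrees

theorem mem_algClosure_of_isRoot {s : Set ℂ} {P : (algClosure s)[X]} (hP : P ≠ 0) {x : ℂ}
    (hx : (P.map (algebraMap (algClosure s) ℂ)).IsRoot x) : x ∈ algClosure s :=
  mem_algClosure_of_isAlgebraic ⟨P, hP, by rwa [aeval_def, ← eval_map]⟩


/-- Six direct motions satisfy three sufficiently independent distance conditions. -/
theorem card_motions_eq_six {s₀ s₁ : Set ℂ} (hs : algClosure s₀ ≤ algClosure s₁)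
    {a b z w m : Fin 3 → ℂ} {l₀ : ℂ}
    (ha : ∀ i, a i ∈ algClosure s₀) (hb : ∀ i, b i ∈ algClosure s₀)
    (hz : ∀ i, z i ∈ algClosure s₀) (hw : ∀ i, w i ∈ algClosure s₀)
    (hm : ∀ i, m i ∈ algClosure s₁) (hl : l₀ ∉ algClosure s₁)
    (hlin : ∀ α β γ, α ∈ algClosure s₀ → β ∈ algClosure s₀ → γ ∈ algClosure s₀ →
      m 1 * α + m 2 * β + γ = 0 → α = 0 ∧ β = 0)
    (ha0 : a 0 = 0) (hb0 : b 0 = 0) (hz0 : z 0 = 0) (hw0 : w 0 = 0)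
    (hlow : (a 1 * a 2 * (w 2 - w 1)) * (w 1 * w 2 * (a 2 - a 1)) ≠ 0)
    (hhigh : (z 1 * z 2 * (b 1 - b 2)) * (b 1 * b 2 * (z 1 - z 2)) ≠ 0)
    (hza : z 2 * a 1 ≠ z 1 * a 2) (hwb : w 2 * b 1 ≠ w 1 * b 2) (hwa : w 2 * a 1 ≠ w 1 * a 2) :
    (motions a b z w ![l₀, l₀ + m 1, l₀ + m 2]).ncard = 6 := by
  set P := elimNum a b z w m - C l₀ * elimDen a b z w with hP
  have hdeg : P.natDegree = 6 := natDegree_elim a b z w m l₀ hhigh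
  have hP0 : P ≠ 0 := fun h => by simp [h] at hdeg
  have hroot0 : ∀ x, P.IsRoot x → x ≠ 0 := by
    rintro x hx rfl
    rw [IsRoot, hP, eval_sub, elimNum_eval_zero] at hx
    simp only [elimDen, eval_mul, eval_X, zero_mul, mul_zero, sub_zero] at hx
    exact hlow hx
  -- A common root with the determinant is algebraic over s₀ and annihilates S or T there. Either is
  -- a linear relation in m 1, m 2 over `algClosure s₀`, so its coefficients vanish: both α or both
  -- β are zero at x, against `hza` or `hwb`.
  have hdet : ∀ x, P.IsRoot x → (elimDet a b z w).eval x ≠ 0 := by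
    intro x hx hd
    have hx0 := hroot0 x hx
    have hmap : (elimDet (fun i => ⟨a i, ha i⟩) (fun i => ⟨b i, hb i⟩) (fun i => ⟨z i, hz i⟩)
        (fun i => ⟨w i, hw i⟩)).map (algebraMap (algClosure s₀) ℂ) = elimDet a b z w :=
      map_elimDet _ _ _ _ _
    have hne : elimDet a b z w ≠ 0 := fun h => by
      have := elimDet_eval_zero a b z w
      rw [h, eval_zero] at this
      exact hwa (sub_eq_zero.mp this.symm)
    have hxK : x ∈ algClosure s₀ := by
      refine mem_algClosure_of_isRoot (P := elimDet (fun i => ⟨a i, ha i⟩) (fun i => ⟨b i, hb i⟩)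
        (fun i => ⟨z i, hz i⟩) (fun i => ⟨w i, hw i⟩)) ?_ (by rwa [hmap])
      rintro h
      rw [h, Polynomial.map_zero] at hmap
      exact hne hmap.symm
    have hST : (elimS a b z w m).eval x * (elimT a b z w m).eval x = 0 := by
      rw [IsRoot, hP, eval_sub, elimNum, elimDen] at hx
      simpa [hd] using hx
    have hα : ∀ i, z i * x - a i ∈ algClosure s₀ := fun i => sub_mem (mul_mem (hz i) hxK) (ha i)
    have hβ : ∀ i, w i - b i * x ∈ algClosure s₀ := fun i => sub_mem (hw i) (mul_mem (hb i) hxK)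
    rcases mul_eq_zero.mp hST with h | h
    · simp only [elimS, elimRho, elimAlpha, elimBeta, eval_sub, eval_mul, eval_C, eval_X] at h
      obtain ⟨h1, h2⟩ := hlin (x * (z 2 * x - a 2)) (-(x * (z 1 * x - a 1)))
        ((z 2 * x - a 2) * (w 2 - b 2 * x) * (z 1 * x - a 1) -
          (z 1 * x - a 1) * (w 1 - b 1 * x) * (z 2 * x - a 2))
        (mul_mem hxK (hα 2)) (neg_mem (mul_mem hxK (hα 1)))
        (sub_mem (mul_mem (mul_mem (hα 2) (hβ 2)) (hα 1))
          (mul_mem (mul_mem (hα 1) (hβ 1)) (hα 2))) (by linear_combination h)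
      have h3 := (mul_eq_zero.mp h1).resolve_left hx0
      have h4 := (mul_eq_zero.mp (neg_eq_zero.mp h2)).resolve_left hx0
      exact hza (by linear_combination z 1 * h3 - z 2 * h4)
    · simp only [elimT, elimRho, elimAlpha, elimBeta, eval_sub, eval_mul, eval_C, eval_X] at h
      obtain ⟨h1, h2⟩ := hlin (-(x * (w 2 - b 2 * x))) (x * (w 1 - b 1 * x))
        ((w 2 - b 2 * x) * (z 1 * x - a 1) * (w 1 - b 1 * x) -
          (w 1 - b 1 * x) * (z 2 * x - a 2) * (w 2 - b 2 * x))
        (neg_mem (mul_mem hxK (hβ 2))) (mul_mem hxK (hβ 1))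
        (sub_mem (mul_mem (mul_mem (hβ 2) (hα 1)) (hβ 1))
          (mul_mem (mul_mem (hβ 1) (hα 2)) (hβ 2))) (by linear_combination h)
      have h3 := (mul_eq_zero.mp (neg_eq_zero.mp h1)).resolve_left hx0
      have h4 := (mul_eq_zero.mp h2).resolve_left hx0
      exact hwb (by linear_combination b 1 * h3 - b 2 * h4)
  -- A multiple root is a critical point of num / den, hence a root of num·den' - num'·den. This
  -- polynomial has coefficients in `algClosure s₁` and is nonzero at 0, so x and then l₀ = num(x) /
  -- den(x) lie in that field, against `hl`.
  have hsimple : ∀ x, P.IsRoot x → ¬ (derivative P).IsRoot x := by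
    intro x hx hx'
    have hx0 := hroot0 x hx
    set A := elimNum (fun i => (⟨a i, hs (ha i)⟩ : algClosure s₁)) (fun i => ⟨b i, hs (hb i)⟩)
      (fun i => ⟨z i, hs (hz i)⟩) (fun i => ⟨w i, hs (hw i)⟩) (fun i => ⟨m i, hm i⟩) with hA
    set B := elimDen (fun i => (⟨a i, hs (ha i)⟩ : algClosure s₁)) (fun i => ⟨b i, hs (hb i)⟩)
      (fun i => ⟨z i, hs (hz i)⟩) (fun i => ⟨w i, hs (hw i)⟩) with hB
    have hmapA : A.map (algebraMap (algClosure s₁) ℂ) = elimNum a b z w m := map_elimNum _ _ _ _ _ _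
    have hmapB : B.map (algebraMap (algClosure s₁) ℂ) = elimDen a b z w := map_elimDen _ _ _ _ _
    have hPx : (elimNum a b z w m).eval x = l₀ * (elimDen a b z w).eval x := by
      rw [IsRoot, hP, eval_sub, eval_mul, eval_C] at hx
      linear_combination hx
    have hPx' : (derivative (elimNum a b z w m)).eval x =
        l₀ * (derivative (elimDen a b z w)).eval x := by
      rw [IsRoot, hP, derivative_sub, derivative_C_mul, eval_sub, eval_mul, eval_C] at hx'
      linear_combination hx'
    have hmapE : (A * derivative B - derivative A * B).map (algebraMap (algClosure s₁) ℂ) =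
        elimNum a b z w m * derivative (elimDen a b z w) -
          derivative (elimNum a b z w m) * elimDen a b z w := by
      rw [Polynomial.map_sub, Polynomial.map_mul, Polynomial.map_mul, ← derivative_map,
        ← derivative_map, hmapA, hmapB]
    have hxK : x ∈ algClosure s₁ := by
      refine mem_algClosure_of_isRoot (P := A * derivative B - derivative A * B) ?_ ?_
      · intro h
        rw [h, Polynomial.map_zero] at hmapE
        have h0 := congrArg (eval 0) hmapE
        rw [eval_sub, eval_mul, eval_mul, elimNum_eval_zero, elimDen, derivative_mul] at h0
        simp only [eval_zero, derivative_X, eval_add, eval_mul, eval_pow, eval_X, eval_one,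
          elimDet_eval_zero] at h0
        refine mul_ne_zero hlow (pow_ne_zero 2 (sub_ne_zero.mpr hwa)) ?_
        linear_combination -h0
      · rw [hmapE, IsRoot, eval_sub, eval_mul, eval_mul, hPx, hPx']
        ring
    have hBx : (elimDen a b z w).eval x ≠ 0 := by
      rw [elimDen, eval_mul, eval_pow, eval_X]
      exact mul_ne_zero hx0 (pow_ne_zero 2 (hdet x hx))
    apply hl
    rw [← mul_div_cancel_right₀ l₀ hBx, ← hPx, ← hmapA, ← hmapB]
    have hev : ∀ Q : (algClosure s₁)[X], (Q.map (algebraMap (algClosure s₁) ℂ)).eval x ∈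
        algClosure s₁ := fun Q => by
      rw [show x = algebraMap (algClosure s₁) ℂ ⟨x, hxK⟩ from rfl, eval_map_apply]
      exact SetLike.coe_mem _
    exact div_mem (hev A) (hev B)
  have hcard : P.roots.toFinset.card = 6 := by
    rw [Multiset.toFinset_card_of_nodup, ← hdeg, (IsAlgClosed.splits P).natDegree_eq_card_roots]
    rw [Multiset.nodup_iff_count_le_one]
    intro x
    rw [count_roots]
    by_contra! h
    have := (one_lt_rootMultiplicity_iff_isRoot hP0).mp h
    exact hsimple x this.1 this.2
  -- Multiplying by x and cancelling the quadratic term s t = l₀ makes each bar condition linear in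
  -- s and t x.
  have hlen : ∀ {x s t : ℂ} (i : Fin 3), x ≠ 0 → s * t = l₀ →
      ((a i - (x * z i + s)) * (b i - (x⁻¹ * w i + t)) = l₀ + m i ↔
        s * (w i - b i * x) + t * x * (z i * x - a i) =
          m i * x - (z i * x - a i) * (w i - b i * x)) := by
    intro x s t i hx hst
    have key : x * ((a i - (x * z i + s)) * (b i - (x⁻¹ * w i + t)) - (l₀ + m i)) =
        s * (w i - b i * x) + t * x * (z i * x - a i) -
          (m i * x - (z i * x - a i) * (w i - b i * x)) := by
      rw [← hst]; field_simp; ring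
    rw [← sub_eq_zero, ← mul_eq_zero_iff_left hx, key, sub_eq_zero]
  -- The motions are parametrised by the roots λ, with s and t given by Cramer's rule.
  have himage : motions a b z w ![l₀, l₀ + m 1, l₀ + m 2] =
      (fun x => (x, (elimS a b z w m).eval x / (elimDet a b z w).eval x,
        (elimT a b z w m).eval x / (x * (elimDet a b z w).eval x))) '' (P.roots.toFinset : Set ℂ) := by
    ext ⟨x, s, t⟩
    simp only [motions, Fin.forall_fin_succ, Set.mem_image, Finset.mem_coe, Multiset.mem_toFinset,
      mem_roots hP0, Prod.mk.injEq]
    constructor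
    · rintro ⟨hx, h0, h1, h2, -⟩
      have hst : s * t = l₀ := by simpa [ha0, hb0, hz0, hw0] using h0
      have e1 := (hlen 1 hx hst).mp h1
      have e2 := (hlen 2 hx hst).mp h2
      have hS : s * (elimDet a b z w).eval x = (elimS a b z w m).eval x := by
        simp only [elimS, elimDet, elimRho, elimAlpha, elimBeta, eval_sub, eval_mul, eval_C, eval_X]
        linear_combination (z 2 * x - a 2) * e1 - (z 1 * x - a 1) * e2
      have hT : t * (x * (elimDet a b z w).eval x) = (elimT a b z w m).eval x := by
        simp only [elimT, elimDet, elimRho, elimAlpha, elimBeta, eval_sub, eval_mul, eval_C, eval_X]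
        linear_combination (w 1 - b 1 * x) * e2 - (w 2 - b 2 * x) * e1
      have hr : P.IsRoot x := by
        rw [IsRoot, hP, eval_sub, elimNum, elimDen, eval_mul, eval_mul, eval_mul, eval_pow, eval_X,
          eval_C, ← hS, ← hT, ← hst]
        ring
      have hd := hdet x hr
      exact ⟨x, hr, rfl, by rw [← hS, mul_div_cancel_right₀ _ hd],
        by rw [← hT, mul_div_cancel_right₀ _ (mul_ne_zero hx hd)]⟩
    · rintro ⟨x, hr, rfl, rfl, rfl⟩
      have hx := hroot0 x hr
      have hd := hdet x hr
      have hst : (elimS a b z w m).eval x / (elimDet a b z w).eval x *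
          ((elimT a b z w m).eval x / (x * (elimDet a b z w).eval x)) = l₀ := by
        rw [IsRoot, hP, eval_sub, elimNum, elimDen, eval_mul, eval_mul, eval_mul, eval_pow, eval_X,
          eval_C] at hr
        field_simp
        linear_combination hr
      refine ⟨hx, by simpa [ha0, hb0, hz0, hw0] using hst, (hlen 1 hx hst).mpr ?_,
        (hlen 2 hx hst).mpr ?_, by simp⟩
      · field_simp
        simp only [elimS, elimT, elimDet, elimRho, elimAlpha, elimBeta, eval_sub, eval_mul, eval_C,
          eval_X]
        ring
      · field_simp
        simp only [elimS, elimT, elimDet, elimRho, elimAlpha, elimBeta, eval_sub, eval_mul, eval_C,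
          eval_X]
        ring
  rw [himage, Set.ncard_image_of_injective _ (fun x y h => congrArg Prod.fst h),
    Set.ncard_coe_finset, hcard]

end PlaneFramework

end

/-! ### Independence of the triangle coordinates and bar lengths -/

section

open AlgebraicIndependent

namespace PlaneFramework

theorem notMem_algClosure_of_independent {ι K : Type*} [Field K] [Algebra ℚ K] {x : ι → K}
    (hx : AlgebraicIndependent ℚ x) (i : ι) : x i ∉ algClosure (x '' {i}ᶜ) := by
  have h := (matroid_indep_range hx).notMem_closure_sdiff_of_mem (Set.mem_range_self i)
  rw [mem_algClosure]
  convert h using 3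
  ext y
  constructor
  · rintro ⟨j, hj, rfl⟩
    exact ⟨⟨j, rfl⟩, fun h => hj (hx.injective h)⟩
  · rintro ⟨⟨j, rfl⟩, hj⟩
    exact ⟨j, fun h => hj (by rw [Set.mem_singleton_iff.mp h]; rfl), rfl⟩

/-- Two generic triangles in normal position can be linked by three generic bars in six ways by a
direct motion, and in six ways by a motion that exchanges the isotropic coordinates. -/
theorem card_motions_of_independent {a b z w l : Fin 3 → ℂ}
    (ha0 : a 0 = 0) (hb0 : b 0 = 0) (hz0 : z 0 = 0) (hw0 : w 0 = 0) (ha1 : a 1 = 1) (hz1 : z 1 = 1)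
    (h : AlgebraicIndependent ℚ
      ![b 1, a 2, b 2, w 1, z 2, w 2, l 1 - l 0, l 2 - l 0, l 0]) :
    (motions a b z w l).ncard = 6 ∧ (motions a b w z l).ncard = 6 := by
  set x : Fin 9 → ℂ := ![b 1, a 2, b 2, w 1, z 2, w 2, l 1 - l 0, l 2 - l 0, l 0] with hx
  have hmem : ∀ (S : Set (Fin 9)) (j : Fin 9), j ∈ S → x j ∈ algClosure (x '' S) :=
    fun S j hj => subset_algClosure _ ⟨j, hj, rfl⟩
  have hne : ∀ (i : Fin 9) (y : ℂ), y ∈ algClosure (x '' {i}ᶜ) → x i ≠ y := fun i y hy he =>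
    notMem_algClosure_of_independent h i (he ▸ hy)
  -- Indices 0 to 5 are the coordinates of the two triangles, 6 and 7 the differences of bar
  -- lengths, 8 the length l 0. The field s₀ uses the first six, s₁ all but the last.
  set S₀ : Set (Fin 9) := {i | i < 6} with hS₀
  have hsub : ∀ i : Fin 9, 6 ≤ i → algClosure (x '' S₀) ≤ algClosure (x '' {i}ᶜ) := fun i hi =>
    algClosure_mono (Set.image_mono fun j (hj : j < 6) (hji : j = i) =>
      absurd (hji ▸ hj) (not_lt.mpr hi))
  have hA : ∀ i, a i ∈ algClosure (x '' S₀) := by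
    intro i; fin_cases i
    · simp [ha0]
    · simp [ha1]
    · exact hmem S₀ 1 (by simp [hS₀])
  have hB : ∀ i, b i ∈ algClosure (x '' S₀) := by
    intro i; fin_cases i
    · simp [hb0]
    · exact hmem S₀ 0 (by simp [hS₀])
    · exact hmem S₀ 2 (by simp [hS₀])
  have hZ : ∀ i, z i ∈ algClosure (x '' S₀) := by
    intro i; fin_cases i
    · simp [hz0]
    · simp [hz1]
    · exact hmem S₀ 4 (by simp [hS₀])
  have hW : ∀ i, w i ∈ algClosure (x '' S₀) := by
    intro i; fin_cases i
    · simp [hw0]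
    · exact hmem S₀ 3 (by simp [hS₀])
    · exact hmem S₀ 5 (by simp [hS₀])
  have hM : ∀ i, l i - l 0 ∈ algClosure (x '' {8}ᶜ) := by
    intro i; fin_cases i
    · simp
    · exact hmem {8}ᶜ 6 (by simp)
    · exact hmem {8}ᶜ 7 (by simp)
  -- A nontrivial relation could be solved for one of the differences, which would then be algebraic
  -- over the other entries.
  have hlin : ∀ α β γ, α ∈ algClosure (x '' S₀) → β ∈ algClosure (x '' S₀) →
      γ ∈ algClosure (x '' S₀) → (l 1 - l 0) * α + (l 2 - l 0) * β + γ = 0 → α = 0 ∧ β = 0 := by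
    intro α β γ hα hβ hγ he
    constructor
    · by_contra h0
      refine hne 6 (-((l 2 - l 0) * β + γ) / α) ?_ ?_
      · have h67 : l 2 - l 0 ∈ algClosure (x '' {6}ᶜ) := hmem {6}ᶜ 7 (by simp)
        exact div_mem (neg_mem (add_mem (mul_mem h67 (hsub 6 le_rfl hβ)) (hsub 6 le_rfl hγ)))
          (hsub 6 le_rfl hα)
      · change l 1 - l 0 = _
        rw [eq_div_iff h0]
        linear_combination he
    · by_contra h0
      refine hne 7 (-((l 1 - l 0) * α + γ) / β) ?_ ?_
      · have h67 : l 1 - l 0 ∈ algClosure (x '' {7}ᶜ) := hmem {7}ᶜ 6 (by simp)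
        exact div_mem (neg_mem (add_mem (mul_mem h67 (hsub 7 (by decide) hα))
          (hsub 7 (by decide) hγ))) (hsub 7 (by decide) hβ)
      · change l 2 - l 0 = _
        rw [eq_div_iff h0]
        linear_combination he
  have hl : l 0 ∉ algClosure (x '' {8}ᶜ) := notMem_algClosure_of_independent h 8
  have hle : (![l 0, l 0 + (l 1 - l 0), l 0 + (l 2 - l 0)] : Fin 3 → ℂ) = l := by
    ext i; fin_cases i <;> simp
  have e0 : b 1 ≠ 0 := hne 0 0 (zero_mem _)
  have e1 : a 2 ≠ 0 := hne 1 0 (zero_mem _)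
  have e1' : a 2 ≠ 1 := hne 1 1 (one_mem _)
  have e2 : b 2 ≠ 0 := hne 2 0 (zero_mem _)
  have e2' : b 2 ≠ b 1 := hne 2 _ (hmem {2}ᶜ 0 (by simp))
  have e3 : w 1 ≠ 0 := hne 3 0 (zero_mem _)
  have e4 : z 2 ≠ 0 := hne 4 0 (zero_mem _)
  have e4' : z 2 ≠ 1 := hne 4 1 (one_mem _)
  have e4a : z 2 ≠ a 2 := hne 4 _ (hmem {4}ᶜ 1 (by simp))
  have e5 : w 2 ≠ 0 := hne 5 0 (zero_mem _)
  have e5' : w 2 ≠ w 1 := hne 5 _ (hmem {5}ᶜ 3 (by simp))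
  have e5a : w 2 ≠ w 1 * a 2 := hne 5 _ (mul_mem (hmem {5}ᶜ 3 (by simp)) (hmem {5}ᶜ 1 (by simp)))
  have e5b : w 2 ≠ w 1 * b 2 / b 1 :=
    hne 5 _ (div_mem (mul_mem (hmem {5}ᶜ 3 (by simp)) (hmem {5}ᶜ 2 (by simp)))
      (hmem {5}ᶜ 0 (by simp)))
  have e4b : z 2 ≠ b 2 / b 1 :=
    hne 4 _ (div_mem (hmem {4}ᶜ 2 (by simp)) (hmem {4}ᶜ 0 (by simp)))
  rw [ne_eq, eq_div_iff e0] at e5b e4b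
  constructor
  · have := card_motions_eq_six (hsub 8 (by decide)) hA hB hZ hW hM hl hlin ha0 hb0 hz0 hw0
      (by simp [ha1, e1, e3, e5, sub_eq_zero, e5', e1'])
      (by simp [hz1, e4, e0, e2, sub_eq_zero, e2'.symm, e4'.symm])
      (by simpa [ha1, hz1] using e4a) e5b (by simpa [ha1] using e5a)
    rwa [hle] at this
  -- The elimination does not use the normalisation z 1 = 1, so z and w may be exchanged; only the
  -- nonvanishing conditions have to be checked anew.
  · have := card_motions_eq_six (hsub 8 (by decide)) hA hB hW hZ hM hl hlin ha0 hb0 hw0 hz0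
      (by simp [ha1, hz1, e1, e4, sub_eq_zero, e4', e1'])
      (by simp [e3, e5, e0, e2, sub_eq_zero, e2'.symm, e5'.symm])
      (by simpa [ha1] using e5a) (by simpa [hz1] using e4b) (by simpa [ha1, hz1] using e4a)
    rwa [hle] at this

/-- The first isotropic coordinate. -/
noncomputable def isoZ {V : Type*} (q : V → Fin 2 → ℂ) (v : V) : ℂ := q v 0 + Complex.I * q v 1

/-- The second isotropic coordinate. -/
noncomputable def isoW {V : Type*} (q : V → Fin 2 → ℂ) (v : V) : ℂ := q v 0 - Complex.I * q v 1

theorem d_sub_eq {V : Type*} (q : V → Fin 2 → ℂ) (a b : V) :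
    d (q a - q b) = (isoZ q a - isoZ q b) * (isoW q a - isoW q b) := by
  simp only [d, isoZ, isoW, Pi.sub_apply]
  linear_combination (q a 1 - q b 1) ^ 2 * Complex.I_sq

theorem edgeLengths_subset_isoLengths {V : Type*} (G : SimpleGraph V) (q : V → Fin 2 → ℂ) :
    edgeLengths G q ⊆ isoLengths (isoZ q) (isoW q) := by
  rintro _ ⟨e, rfl⟩
  exact ⟨e.1, (d_sub_eq q _ _).symm⟩

theorem Equivalent.edgeLengths_eq {V K : Type*} [CommRing K] {G : SimpleGraph V}
    {p q : V → Fin 2 → K} (h : Equivalent G p q) : edgeLengths G q = edgeLengths G p := by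
  unfold edgeLengths
  congr 1
  ext e
  exact (h _ _ e.2).symm

/-- In a framework with maximal rank all squared distances are algebraic over the edge lengths. -/
theorem d_mem_algClosure {V : Type*} [Finite V] {G : SimpleGraph V} {p : V → Fin 2 → ℂ}
    (hr : (2 * Nat.card V : ℕ∞) ≤ (matroid ℚ ℂ).eRk (edgeLengths G p) + 3) (a b : V) :
    d (p a - p b) ∈ algClosure (edgeLengths G p) := by
  by_cases hab : a = b
  · subst hab; simp [d]
  -- The edge lengths lie among all squared distances and already attain their maximal rank, so both
  -- sets have the same closure.
  have h1 := (eRk_isoLengths_le (isoZ p) (isoW p) hab).trans hr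
  have h2 : (matroid ℚ ℂ).eRk (isoLengths (isoZ p) (isoW p)) ≤
      (matroid ℚ ℂ).eRk (edgeLengths G p) := by
    rwa [ENat.add_le_add_iff_right (by norm_num)] at h1
  have hfin : (edgeLengths G p).Finite := Set.finite_range _
  have h3 := Matroid.IsRkFinite.closure_eq_closure_of_subset_of_eRk_ge_eRk
    ((matroid ℚ ℂ).isRkFinite_of_finite hfin) (edgeLengths_subset_isoLengths G p) h2
  rw [mem_algClosure, h3, ← mem_algClosure, d_sub_eq]
  exact subset_algClosure _ ⟨(a, b), rfl⟩

/-- An isotropic pair would lower the rank to 2|V| - 4. No genericity of p is assumed, so this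
applies to every realisation equivalent to one of maximal rank. -/
theorem d_ne_zero_of_rank {V : Type*} [Finite V] {G : SimpleGraph V} {p : V → Fin 2 → ℂ}
    (hr : (2 * Nat.card V : ℕ∞) ≤ (matroid ℚ ℂ).eRk (edgeLengths G p) + 3) {a b : V} (hab : a ≠ b) :
    (isoZ p b - isoZ p a) * (isoW p b - isoW p a) ≠ 0 := by
  intro h
  have h1 := eRk_isoLengths_degenerate (isoZ p) (isoW p) hab h
  have h2 := (matroid ℚ ℂ).eRk_mono (edgeLengths_subset_isoLengths G p)
  have h3 := h1.trans (hr.trans (add_le_add_left h2 3))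
  have hfin : (isoLengths (isoZ p) (isoW p)).Finite := Set.finite_range _
  have h4 := ((matroid ℚ ℂ).isRkFinite_of_finite hfin).eRk_lt_top
  lift (matroid ℚ ℂ).eRk (isoLengths (isoZ p) (isoW p)) to ℕ using h4.ne with n
  norm_cast at h3
  omega

/-- The squared lengths of the three linking edges. -/
def linkLengths {V₁ V₂ K : Type*} [CommRing K] (u : Fin 3 → V₁) (v : Fin 3 → V₂)
    (p : V₁ ⊕ V₂ → Fin 2 → K) (i : Fin 3) : K := d (p (.inl (u i)) - p (.inr (v i)))

theorem joinThree_adj {V₁ V₂ : Type*} {G₁ : SimpleGraph V₁} {G₂ : SimpleGraph V₂}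
    {u : Fin 3 → V₁} {v : Fin 3 → V₂} :
    (∀ a b, (joinThree G₁ G₂ u v).Adj (.inl a) (.inl b) ↔ G₁.Adj a b) ∧
    (∀ a b, (joinThree G₁ G₂ u v).Adj (.inr a) (.inr b) ↔ G₂.Adj a b) ∧
    (∀ a b, (joinThree G₁ G₂ u v).Adj (.inl a) (.inr b) ↔ ∃ i, u i = a ∧ v i = b) ∧
    (∀ a b, (joinThree G₁ G₂ u v).Adj (.inr b) (.inl a) ↔ ∃ i, u i = a ∧ v i = b) := by
  refine ⟨?_, ?_, ?_, ?_⟩ <;> intros <;> simp [joinThree]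

theorem d_neg {K : Type*} [CommRing K] (P Q : Fin 2 → K) : d (P - Q) = d (Q - P) := by
  simp only [d, Pi.sub_apply]; ring

theorem equivalent_joinThree {V₁ V₂ K : Type*} [CommRing K] {G₁ : SimpleGraph V₁}
    {G₂ : SimpleGraph V₂} {u : Fin 3 → V₁} {v : Fin 3 → V₂} {p q : V₁ ⊕ V₂ → Fin 2 → K} :
    Equivalent (joinThree G₁ G₂ u v) p q ↔
      Equivalent G₁ (p ∘ .inl) (q ∘ .inl) ∧ Equivalent G₂ (p ∘ .inr) (q ∘ .inr) ∧
        linkLengths u v p = linkLengths u v q := by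
  obtain ⟨h1, h2, h3, h4⟩ := joinThree_adj (G₁ := G₁) (G₂ := G₂) (u := u) (v := v)
  constructor
  · intro h
    exact ⟨fun a b hab => h _ _ ((h1 a b).mpr hab), fun a b hab => h _ _ ((h2 a b).mpr hab),
      funext fun i => h _ _ ((h3 _ _).mpr ⟨i, rfl, rfl⟩)⟩
  · rintro ⟨e1, e2, e3⟩ (a | a) (b | b) hab
    · exact e1 a b ((h1 a b).mp hab)
    · obtain ⟨i, rfl, rfl⟩ := (h3 _ _).mp hab
      exact congrFun e3 i
    · obtain ⟨i, rfl, rfl⟩ := (h4 _ _).mp hab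
      rw [d_neg, d_neg (q _)]
      exact congrFun e3 i
    · exact e2 a b ((h2 a b).mp hab)

theorem edgeLengths_joinThree_subset {V₁ V₂ K : Type*} [CommRing K] (G₁ : SimpleGraph V₁)
    (G₂ : SimpleGraph V₂) (u : Fin 3 → V₁) (v : Fin 3 → V₂) (p : V₁ ⊕ V₂ → Fin 2 → K) :
    edgeLengths (joinThree G₁ G₂ u v) p ⊆
      edgeLengths G₁ (p ∘ .inl) ∪ edgeLengths G₂ (p ∘ .inr) ∪ Set.range (linkLengths u v p) := by
  obtain ⟨h1, h2, h3, h4⟩ := joinThree_adj (G₁ := G₁) (G₂ := G₂) (u := u) (v := v)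
  rintro _ ⟨⟨⟨a | a, b | b⟩, hab⟩, rfl⟩
  · exact Or.inl (Or.inl ⟨⟨(a, b), (h1 a b).mp hab⟩, rfl⟩)
  · obtain ⟨i, rfl, rfl⟩ := (h3 _ _).mp hab
    exact Or.inr ⟨i, rfl⟩
  · obtain ⟨i, rfl, rfl⟩ := (h4 _ _).mp hab
    exact Or.inr ⟨i, d_neg _ _⟩
  · exact Or.inl (Or.inr ⟨⟨(a, b), (h2 a b).mp hab⟩, rfl⟩)

section Rank

variable {V₁ V₂ : Type*} [Finite V₁] [Finite V₂] {G₁ : SimpleGraph V₁} {G₂ : SimpleGraph V₂}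
  {u : Fin 3 → V₁} {v : Fin 3 → V₂} {p : V₁ ⊕ V₂ → Fin 2 → ℂ}

/-- If a linked framework has maximal rank then so do its two parts. -/
theorem rank_parts (hu : Function.Injective u) (hv : Function.Injective v)
    (hr : (2 * Nat.card (V₁ ⊕ V₂) : ℕ∞) ≤
      (matroid ℚ ℂ).eRk (edgeLengths (joinThree G₁ G₂ u v) p) + 3) :
    (2 * Nat.card V₁ : ℕ∞) ≤ (matroid ℚ ℂ).eRk (edgeLengths G₁ (p ∘ .inl)) + 3 ∧
      (2 * Nat.card V₂ : ℕ∞) ≤ (matroid ℚ ℂ).eRk (edgeLengths G₂ (p ∘ .inr)) + 3 := by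
  -- The whole rank is at most r₁ + r₂ + 3, while rᵢ ≤ 2|Vᵢ| - 3. A total of 2|V₁| + 2|V₂| - 3
  -- therefore forces equality in both parts.
  have h1 := (matroid ℚ ℂ).eRk_mono (edgeLengths_joinThree_subset G₁ G₂ u v p)
  have h2 := h1.trans ((Matroid.eRk_union_le_eRk_add_encard _ _ _).trans
    (add_le_add_left ((matroid ℚ ℂ).eRk_union_le_eRk_add_eRk _ _) _))
  have h3 : (Set.range (linkLengths u v p)).encard ≤ 3 := by
    rw [← Set.image_univ]
    refine (Set.encard_image_le _ _).trans ?_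
    simp [Set.encard_univ]
  have h4 := (add_le_add_left ((matroid ℚ ℂ).eRk_mono
    (edgeLengths_subset_isoLengths G₁ (p ∘ .inl))) 3).trans
    (eRk_isoLengths_le _ _ (hu.ne (show (0 : Fin 3) ≠ 1 by decide)))
  have h5 := (add_le_add_left ((matroid ℚ ℂ).eRk_mono
    (edgeLengths_subset_isoLengths G₂ (p ∘ .inr))) 3).trans
    (eRk_isoLengths_le _ _ (hv.ne (show (0 : Fin 3) ≠ 1 by decide)))
  have h6 := hr.trans (add_le_add_left (h2.trans (add_le_add_right h3 _)) 3)
  rw [Nat.card_sum] at h6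
  generalize (matroid ℚ ℂ).eRk (edgeLengths G₁ (p ∘ .inl)) = x at *
  generalize (matroid ℚ ℂ).eRk (edgeLengths G₂ (p ∘ .inr)) = y at *
  have hx : x ≠ ⊤ := by rintro rfl; simp at h4; exact absurd h4 (by exact_mod_cast ENat.natCast_ne_top _)
  have hy : y ≠ ⊤ := by rintro rfl; simp at h5; exact absurd h5 (by exact_mod_cast ENat.natCast_ne_top _)
  lift x to ℕ using hx
  lift y to ℕ using hy
  norm_cast at *
  omega

/-- The coordinates of two triangles in normal position and the lengths of the links are
independent. -/
theorem independent_of_normal (hu : Function.Injective u) (hv : Function.Injective v)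
    (hr : (2 * Nat.card (V₁ ⊕ V₂) : ℕ∞) ≤
      (matroid ℚ ℂ).eRk (edgeLengths (joinThree G₁ G₂ u v) p) + 3)
    {Z₁ W₁ : V₁ → ℂ} {Z₂ W₂ : V₂ → ℂ}
    (h₁ : edgeLengths G₁ (p ∘ .inl) ⊆ isoLengths Z₁ W₁)
    (h₂ : edgeLengths G₂ (p ∘ .inr) ⊆ isoLengths Z₂ W₂)
    (hZ₁ : Z₁ (u 0) = 0) (hW₁ : W₁ (u 0) = 0) (hZ₁' : Z₁ (u 1) = 1)
    (hZ₂ : Z₂ (v 0) = 0) (hW₂ : W₂ (v 0) = 0) (hZ₂' : Z₂ (v 1) = 1) :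
    AlgebraicIndependent ℚ ![W₁ (u 1), Z₁ (u 2), W₁ (u 2), W₂ (v 1), Z₂ (v 2), W₂ (v 2),
      linkLengths u v p 1 - linkLengths u v p 0, linkLengths u v p 2 - linkLengths u v p 0,
      linkLengths u v p 0] := by
  set l := linkLengths u v p with hl
  set x : Fin 9 → ℂ := ![W₁ (u 1), Z₁ (u 2), W₁ (u 2), W₂ (v 1), Z₂ (v 2), W₂ (v 2),
      l 1 - l 0, l 2 - l 0, l 0] with hx
  obtain ⟨R₁, hR₁, hs₁⟩ := isoLengths_subset_of_normal Z₁ W₁ hu hZ₁ hW₁ hZ₁'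
  obtain ⟨R₂, hR₂, hs₂⟩ := isoLengths_subset_of_normal Z₂ W₂ hv hZ₂ hW₂ hZ₂'
  -- Each part is generated by its triangle and at most 2|Vᵢ| - 6 further coordinates, so a total
  -- rank of 2|V₁| + 2|V₂| - 3 leaves at least 9 for the nine listed numbers.
  apply algebraicIndependent_of_card_le_eRk
  have hsub : edgeLengths (joinThree G₁ G₂ u v) p ⊆
      algClosure (Set.range x ∪ (R₁ ∪ R₂)) := by
    refine (edgeLengths_joinThree_subset G₁ G₂ u v p).trans
      (Set.union_subset (Set.union_subset ?_ ?_) ?_)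
    · refine (h₁.trans hs₁).trans (algClosure_mono ?_)
      refine Set.union_subset_union ?_ Set.subset_union_left
      rintro y (rfl | rfl | rfl)
      · exact ⟨0, rfl⟩
      · exact ⟨1, rfl⟩
      · exact ⟨2, rfl⟩
    · refine (h₂.trans hs₂).trans (algClosure_mono ?_)
      refine Set.union_subset_union ?_ Set.subset_union_right
      rintro y (rfl | rfl | rfl)
      · exact ⟨3, rfl⟩
      · exact ⟨4, rfl⟩
      · exact ⟨5, rfl⟩
    · have hm : ∀ i, x i ∈ algClosure (Set.range x ∪ (R₁ ∪ R₂)) := fun i =>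
        subset_algClosure _ (Or.inl ⟨i, rfl⟩)
      rintro _ ⟨i, rfl⟩
      fin_cases i
      · exact hm 8
      · have := add_mem (hm 6) (hm 8)
        simpa [hx] using this
      · have := add_mem (hm 7) (hm 8)
        simpa [hx] using this
  have h3 := (eRk_le_of_subset_algClosure hsub).trans
    ((Matroid.eRk_union_le_eRk_add_encard _ _ _).trans
      (add_le_add_right (Set.encard_union_le R₁ R₂) _))
  have h4 := hr.trans (add_le_add_left h3 3)
  rw [Nat.card_sum] at h4
  generalize (matroid ℚ ℂ).eRk (Set.range x) = y at *
  have hr₁ : R₁.encard ≠ ⊤ := by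
    intro h; rw [h] at hR₁; simp at hR₁; exact absurd hR₁ (by exact_mod_cast ENat.natCast_ne_top _)
  have hr₂ : R₂.encard ≠ ⊤ := by
    intro h; rw [h] at hR₂; simp at hR₂; exact absurd hR₂ (by exact_mod_cast ENat.natCast_ne_top _)
  generalize R₁.encard = r₁ at *
  generalize R₂.encard = r₂ at *
  by_cases hy : y = ⊤
  · rw [hy]; exact le_top
  lift y to ℕ using hy
  lift r₁ to ℕ using hr₁
  lift r₂ to ℕ using hr₂
  rw [ENat.card_eq_coe_natCard, Nat.card_fin]
  norm_cast at *
  omega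

end Rank

end PlaneFramework

end

/-! ### Normal position, and congruences as motions -/

section

open AlgebraicIndependent

namespace PlaneFramework

/-- The realisation with given isotropic coordinates. -/
noncomputable def realise {V : Type*} (Z W : V → ℂ) : V → Fin 2 → ℂ :=
  fun v => ![(Z v + W v) / 2, (Z v - W v) / (2 * Complex.I)]

theorem isoZ_realise {V : Type*} (Z W : V → ℂ) : isoZ (realise Z W) = Z := by
  ext v
  simp only [isoZ, realise, Matrix.cons_val_zero, Matrix.cons_val_one]
  field_simp [Complex.I_ne_zero]
  ring

theorem isoW_realise {V : Type*} (Z W : V → ℂ) : isoW (realise Z W) = W := by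
  ext v
  simp only [isoW, realise, Matrix.cons_val_zero, Matrix.cons_val_one]
  field_simp [Complex.I_ne_zero]
  ring

theorem d_realise {V : Type*} (Z W : V → ℂ) (a b : V) :
    d (realise Z W a - realise Z W b) = (Z a - Z b) * (W a - W b) := by
  rw [d_sub_eq, isoZ_realise, isoW_realise]

theorem Congruent.symm {V K : Type*} [CommRing K] {p q : V → Fin 2 → K} (h : Congruent p q) :
    Congruent q p := fun a b => (h a b).symm

theorem Congruent.trans {V K : Type*} [CommRing K] {p q r : V → Fin 2 → K} (h : Congruent p q)
    (h' : Congruent q r) : Congruent p r := fun a b => (h a b).trans (h' a b)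

theorem Equivalent.trans_congruent {V K : Type*} [CommRing K] {G : SimpleGraph V}
    {p q r : V → Fin 2 → K} (h : Equivalent G p q) (h' : Congruent q r) : Equivalent G p r :=
  fun a b hab => (h a b hab).trans (h' a b)

theorem congruent_realise {V : Type*} {Z W Z' W' : V → ℂ}
    (h : ∀ a b, (Z a - Z b) * (W a - W b) = (Z' a - Z' b) * (W' a - W' b)) :
    Congruent (realise Z W) (realise Z' W') := fun a b => by
  rw [d_realise, d_realise, h]

theorem congruent_realise_swap {V : Type*} (Z W : V → ℂ) :
    Congruent (realise Z W) (realise W Z) := congruent_realise fun _ _ => mul_comm _ _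

theorem congruent_realise_iso {V : Type*} (q : V → Fin 2 → ℂ) :
    Congruent q (realise (isoZ q) (isoW q)) := fun a b => by rw [d_realise, d_sub_eq]

/-- The realisation obtained by a direct motion `(Z, W) ↦ (λ Z + s, λ⁻¹ W + t)`. -/
noncomputable def moveZ {V : Type*} (Z : V → ℂ) (x : ℂ × ℂ × ℂ) (v : V) : ℂ := x.1 * Z v + x.2.1

noncomputable def moveW {V : Type*} (W : V → ℂ) (x : ℂ × ℂ × ℂ) (v : V) : ℂ := x.1⁻¹ * W v + x.2.2

theorem congruent_move {V : Type*} (Z W : V → ℂ) {x : ℂ × ℂ × ℂ} (hx : x.1 ≠ 0) :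
    Congruent (realise Z W) (realise (moveZ Z x) (moveW W x)) :=
  congruent_realise fun a b => by
    simp only [moveZ, moveW]; field_simp; ring

/-- Normal position of a realisation in isotropic coordinates with respect to a proper triangle. -/
structure IsNormal {V : Type*} (Z W : V → ℂ) (u : Fin 3 → V) : Prop where
  Z_zero : Z (u 0) = 0
  W_zero : W (u 0) = 0
  Z_one : Z (u 1) = 1
  W_one : W (u 1) ≠ 0
  W_two : W (u 2) ≠ Z (u 2) * W (u 1)

/-- Subtracting the first equation from the other two leaves a linear system for (p, r), and `hd`
says that its determinant is nonzero. -/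
theorem eq_of_three_distances {p r z w zb wb zc wc : ℂ} (h : p * r = z * w)
    (hb : (p - zb) * (r - wb) = (z - zb) * (w - wb))
    (hc : (p - zc) * (r - wc) = (z - zc) * (w - wc)) (hd : zb * wc ≠ zc * wb) : p = z ∧ r = w := by
  have hd' := sub_ne_zero.mpr hd
  constructor
  · refine sub_eq_zero.mp ((mul_eq_zero.mp (?_ : (zb * wc - zc * wb) * (p - z) = 0)).resolve_left hd')
    linear_combination (zb - zc) * h + zc * hb - zb * hc
  · refine sub_eq_zero.mp ((mul_eq_zero.mp (?_ : (zb * wc - zc * wb) * (r - w) = 0)).resolve_left hd')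
    linear_combination (wc - wb) * h - wc * hb + wb * hc

/-- Two congruent realisations, the first one in normal position, differ by a motion. -/
theorem IsNormal.exists_motion {V : Type*} {Z W Z' W' : V → ℂ} {u : Fin 3 → V}
    (hn : IsNormal Z W u)
    (h : ∀ a b, (Z' a - Z' b) * (W' a - W' b) = (Z a - Z b) * (W a - W b)) :
    ∃ x : ℂ × ℂ × ℂ, x.1 ≠ 0 ∧ ((Z' = moveZ Z x ∧ W' = moveW W x) ∨
      (Z' = moveZ W x ∧ W' = moveW Z x)) := by
  obtain ⟨hZ0, hW0, hZ1, hW1, hW2⟩ := hn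
  set s := Z' (u 0) with hs
  set t := W' (u 0) with ht
  set x := Z' (u 1) - s with hx
  have h0 : ∀ a, (Z' a - s) * (W' a - t) = Z a * W a := fun a => by
    have := h a (u 0); rwa [hZ0, hW0, sub_zero, sub_zero] at this
  have hx1 : x * (W' (u 1) - t) = W (u 1) := by rw [hx, h0, hZ1, one_mul]
  have hx0 : x ≠ 0 := fun h => hW1 (by rw [← hx1, h, zero_mul])
  have hw1 : W' (u 1) - t = x⁻¹ * W (u 1) := by rw [← hx1, inv_mul_cancel_left₀ hx0]
  -- all vertices are determined once two of them are
  have hall : ∀ (A B : V → ℂ) (y : ℂ), y ≠ 0 → (∀ a b, (A a - A b) * (B a - B b) =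
      (Z a - Z b) * (W a - W b)) → A (u 0) = 0 → B (u 0) = 0 →
      A (u 1) * B (u 2) ≠ A (u 2) * B (u 1) →
      Z' (u 1) - s = y * A (u 1) → W' (u 1) - t = y⁻¹ * B (u 1) →
      Z' (u 2) - s = y * A (u 2) → W' (u 2) - t = y⁻¹ * B (u 2) →
      Z' = moveZ A (y, s, t) ∧ W' = moveW B (y, s, t) := by
    intro A B y hy hAB hA0 hB0 hd e1 e2 e3 e4
    have hA : ∀ a, A a * B a = Z a * W a := fun a => by
      have := hAB a (u 0); rwa [hZ0, hW0, hA0, hB0, sub_zero, sub_zero, sub_zero, sub_zero] at this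
    have key : ∀ a, y⁻¹ * (Z' a - s) = A a ∧ y * (W' a - t) = B a := by
      intro a
      refine eq_of_three_distances (zb := A (u 1)) (wb := B (u 1)) (zc := A (u 2))
        (wc := B (u 2)) ?_ ?_ ?_ hd
      · rw [hA, ← h0]; field_simp
      · rw [hAB, ← h a (u 1)]
        have e1' : Z' (u 1) = y * A (u 1) + s := by linear_combination e1
        have e2' : W' (u 1) = y⁻¹ * B (u 1) + t := by linear_combination e2
        rw [e1', e2']; field_simp; ring
      · rw [hAB, ← h a (u 2)]
        have e1' : Z' (u 2) = y * A (u 2) + s := by linear_combination e3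
        have e2' : W' (u 2) = y⁻¹ * B (u 2) + t := by linear_combination e4
        rw [e1', e2']; field_simp; ring
    constructor <;> ext a
    · rw [moveZ, ← (key a).1]; field_simp; ring
    · rw [moveW, ← (key a).2]; field_simp; ring
  have h2 := h0 (u 2)
  have h3 := h (u 2) (u 1)
  rw [hZ1] at h3
  have h4 : (x⁻¹ * (Z' (u 2) - s)) * W (u 1) + x * (W' (u 2) - t) =
      Z (u 2) * W (u 1) + W (u 2) := by
    have e1' : Z' (u 1) = x + s := by rw [hx]; ring
    have e2' : W' (u 1) = x⁻¹ * W (u 1) + t := by linear_combination hw1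
    rw [e1', e2'] at h3
    have h5 : x⁻¹ * x = 1 := inv_mul_cancel₀ hx0
    linear_combination h2 - h3 + W (u 1) * h5
  have h5 : (x⁻¹ * (Z' (u 2) - s)) * (x * (W' (u 2) - t)) = Z (u 2) * W (u 2) := by
    rw [← h2]; field_simp
  -- The relations h4 and h5 give a quadratic equation for the normalised Z-coordinate of the third
  -- vertex. One root is the direct motion, the other the exchange of Z and W.
  have h6 : (x⁻¹ * (Z' (u 2) - s) - Z (u 2)) * (x⁻¹ * (Z' (u 2) - s) * W (u 1) - W (u 2)) = 0 := by
    linear_combination x⁻¹ * (Z' (u 2) - s) * h4 - h5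
  rcases mul_eq_zero.mp h6 with h7 | h7
  · refine ⟨(x, s, t), hx0, Or.inl (hall Z W x hx0 (fun _ _ => rfl) hZ0 hW0 ?_ ?_ hw1 ?_ ?_)⟩
    · rw [hZ1, one_mul]; exact hW2
    · rw [hZ1, mul_one]
    · rw [← sub_eq_zero.mp h7]; field_simp
    · have : x * (W' (u 2) - t) = W (u 2) := by linear_combination h4 - W (u 1) * h7
      rw [← this]; field_simp
  -- In the exchanged case x is the scale times W (u 1) rather than Z (u 1) = 1, hence this scale.
  · have hy : x * (W (u 1))⁻¹ ≠ 0 := mul_ne_zero hx0 (inv_ne_zero hW1)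
    refine ⟨(x * (W (u 1))⁻¹, s, t), hy, Or.inr (hall W Z _ hy (fun _ _ => mul_comm _ _)
      hW0 hZ0 ?_ ?_ ?_ ?_ ?_)⟩
    · rw [hZ1, mul_one, mul_comm]; exact hW2.symm
    · rw [inv_mul_cancel_right₀ hW1]
    · rw [hw1, hZ1]; field_simp
    · rw [← sub_eq_zero.mp h7]; field_simp
    · have : x * (W' (u 2) - t) = Z (u 2) * W (u 1) := by linear_combination h4 - h7
      have h8 : Z (u 2) = x * (W' (u 2) - t) * (W (u 1))⁻¹ := by rw [this]; field_simp
      rw [h8]; field_simp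

/-- A realisation in normal position is determined by its congruence class and the isotropic
coordinates of the triangle. -/
theorem IsNormal.eq_of_congruent {V : Type*} {Z W Z' W' : V → ℂ} {u : Fin 3 → V}
    (hn : IsNormal Z W u) (hZ : ∀ i, Z' (u i) = Z (u i)) (hW : ∀ i, W' (u i) = W (u i))
    (h : Congruent (realise Z W) (realise Z' W')) : Z' = Z ∧ W' = W := by
  obtain ⟨x, hx0, ⟨rfl, rfl⟩ | ⟨rfl, rfl⟩⟩ := hn.exists_motion (Z' := Z') (W' := W') fun a b => by
    rw [← d_realise, ← d_realise, h a b]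
  · have h0 := hZ 0
    have h1 := hZ 1
    have h2 := hW 0
    simp only [moveZ, moveW, hn.Z_zero, hn.W_zero, hn.Z_one, mul_zero, zero_add, mul_one] at h0 h1 h2
    rw [h0, add_zero] at h1
    constructor <;> ext a
    · rw [moveZ, h0, h1]; ring
    · rw [moveW, h2, h1]; simp
  -- An exchange that fixes the Z-coordinates of the triangle would make W proportional to Z on it,
  -- against `W_two`.
  · exfalso
    have h0 := hZ 0
    have h1 := hZ 1
    have h2 := hZ 2
    simp only [moveZ, hn.Z_zero, hn.W_zero, hn.Z_one, mul_zero, zero_add] at h0 h1 h2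
    rw [h0, add_zero] at h1 h2
    apply hn.W_two
    rw [← h2]
    linear_combination -W (u 2) * h1

theorem isNormal_of_independent {V₁ V₂ : Type*} {Z₁ W₁ : V₁ → ℂ} {Z₂ W₂ : V₂ → ℂ} {u : Fin 3 → V₁}
    {v : Fin 3 → V₂} {m₁ m₂ l : ℂ}
    (hZ₁ : Z₁ (u 0) = 0) (hW₁ : W₁ (u 0) = 0) (hZ₁' : Z₁ (u 1) = 1)
    (hZ₂ : Z₂ (v 0) = 0) (hW₂ : W₂ (v 0) = 0) (hZ₂' : Z₂ (v 1) = 1)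
    (h : AlgebraicIndependent ℚ ![W₁ (u 1), Z₁ (u 2), W₁ (u 2), W₂ (v 1), Z₂ (v 2), W₂ (v 2),
      m₁, m₂, l]) : IsNormal Z₁ W₁ u ∧ IsNormal Z₂ W₂ v := by
  set x : Fin 9 → ℂ := ![W₁ (u 1), Z₁ (u 2), W₁ (u 2), W₂ (v 1), Z₂ (v 2), W₂ (v 2), m₁, m₂, l]
  have hmem : ∀ i j : Fin 9, j ≠ i → x j ∈ algClosure (x '' {i}ᶜ) :=
    fun S j hj => subset_algClosure _ ⟨j, hj, rfl⟩
  have hne : ∀ (i : Fin 9) (y : ℂ), y ∈ algClosure (x '' {i}ᶜ) → x i ≠ y := fun i y hy he =>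
    notMem_algClosure_of_independent h i (he ▸ hy)
  exact ⟨⟨hZ₁, hW₁, hZ₁', hne 0 0 (zero_mem _),
    hne 2 _ (mul_mem (hmem 2 1 (by decide)) (hmem 2 0 (by decide)))⟩,
    ⟨hZ₂, hW₂, hZ₂', hne 3 0 (zero_mem _),
    hne 5 _ (mul_mem (hmem 5 4 (by decide)) (hmem 5 3 (by decide)))⟩⟩

/-- Equivalent realisations share their edge lengths and so the rank condition; the first two
triangle vertices are thus not in isotropic position, and Z (u 1) can be scaled to 1. -/
theorem exists_normal_representative {V : Type*} [Finite V] {G : SimpleGraph V}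
    {p : V → Fin 2 → ℂ} {u : Fin 3 → V} (hu : Function.Injective u)
    (hr : (2 * Nat.card V : ℕ∞) ≤ (matroid ℚ ℂ).eRk (edgeLengths G p) + 3)
    (y : Quotient (congruenceSetoid G p)) :
    ∃ (Z W : V → ℂ) (h : Equivalent G p (realise Z W)), Z (u 0) = 0 ∧ W (u 0) = 0 ∧ Z (u 1) = 1 ∧
      (⟦⟨realise Z W, h⟩⟧ : Quotient (congruenceSetoid G p)) = y := by
  induction y using Quotient.inductionOn with
  | _ q =>
    obtain ⟨q, hq⟩ := q
    have hne := d_ne_zero_of_rank (p := q) (G := G) (by rw [hq.edgeLengths_eq]; exact hr)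
      (hu.ne (show (0 : Fin 3) ≠ 1 by decide))
    have hz := left_ne_zero_of_mul hne
    have hc : Congruent q (realise (fun v => (isoZ q (u 1) - isoZ q (u 0))⁻¹ * (isoZ q v - isoZ q (u 0)))
        (fun v => (isoZ q (u 1) - isoZ q (u 0)) * (isoW q v - isoW q (u 0)))) :=
      (congruent_realise_iso q).trans (congruent_realise fun a b => by field_simp; ring)
    exact ⟨_, _, hq.trans_congruent hc, by simp, by simp, inv_mul_cancel₀ hz,
      Quotient.sound hc.symm⟩

end PlaneFramework

end

/-! ### The fibres of restriction to the two parts -/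

section

open AlgebraicIndependent

namespace PlaneFramework

/-- Restriction of equivalence classes of realisations of a linked graph to the two parts. -/
def restrictClasses {V₁ V₂ : Type*} (G₁ : SimpleGraph V₁) (G₂ : SimpleGraph V₂)
    (u : Fin 3 → V₁) (v : Fin 3 → V₂) (p : V₁ ⊕ V₂ → Fin 2 → ℂ) :
    Quotient (congruenceSetoid (joinThree G₁ G₂ u v) p) →
      Quotient (congruenceSetoid G₁ (p ∘ .inl)) × Quotient (congruenceSetoid G₂ (p ∘ .inr)) :=
  Quotient.lift (fun q => (⟦⟨q.1 ∘ .inl, (equivalent_joinThree.mp q.2).1⟩⟧,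
    ⟦⟨q.1 ∘ .inr, (equivalent_joinThree.mp q.2).2.1⟩⟧)) fun _ _ h =>
      Prod.ext (Quotient.sound fun a b => h (.inl a) (.inl b))
        (Quotient.sound fun a b => h (.inr a) (.inr b))

theorem linkLengths_realise {V₁ V₂ : Type*} (u : Fin 3 → V₁) (v : Fin 3 → V₂) (Z W : V₁ ⊕ V₂ → ℂ)
    (i : Fin 3) : linkLengths u v (realise Z W) i =
      (Z (.inl (u i)) - Z (.inr (v i))) * (W (.inl (u i)) - W (.inr (v i))) :=
  d_realise _ _ _ _

/-- Putting the first part in its standard place uses up all motions, since a normal triangle has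
trivial stabiliser. The fibre then corresponds to the placements of the second part that respect the
bars: six direct and six exchanged. -/
theorem card_fibre_restrictClasses {V₁ V₂ : Type*} [Finite V₁] [Finite V₂] {G₁ : SimpleGraph V₁}
    {G₂ : SimpleGraph V₂} {u : Fin 3 → V₁} {v : Fin 3 → V₂} {p : V₁ ⊕ V₂ → Fin 2 → ℂ}
    (hu : Function.Injective u) (hv : Function.Injective v)
    (hr : (2 * Nat.card (V₁ ⊕ V₂) : ℕ∞) ≤
      (matroid ℚ ℂ).eRk (edgeLengths (joinThree G₁ G₂ u v) p) + 3)
    (y : Quotient (congruenceSetoid G₁ (p ∘ .inl)) × Quotient (congruenceSetoid G₂ (p ∘ .inr))) :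
    Nat.card {c // restrictClasses G₁ G₂ u v p c = y} = 12 := by
  obtain ⟨hr₁, hr₂⟩ := rank_parts hu hv hr
  obtain ⟨y₁, y₂⟩ := y
  obtain ⟨Z₁, W₁, he₁, hZ₁, hW₁, hZ₁', rfl⟩ := exists_normal_representative hu hr₁ y₁
  obtain ⟨Z₂, W₂, he₂, hZ₂, hW₂, hZ₂', rfl⟩ := exists_normal_representative hv hr₂ y₂
  have hind := independent_of_normal hu hv hr (Z₁ := Z₁) (W₁ := W₁) (Z₂ := Z₂) (W₂ := W₂)
    (by
      rw [← he₁.edgeLengths_eq]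
      simpa only [isoZ_realise, isoW_realise] using edgeLengths_subset_isoLengths G₁ (realise Z₁ W₁))
    (by
      rw [← he₂.edgeLengths_eq]
      simpa only [isoZ_realise, isoW_realise] using edgeLengths_subset_isoLengths G₂ (realise Z₂ W₂))
    hZ₁ hW₁ hZ₁' hZ₂ hW₂ hZ₂'
  obtain ⟨hn₁, hn₂⟩ := isNormal_of_independent hZ₁ hW₁ hZ₁' hZ₂ hW₂ hZ₂' hind
  obtain ⟨hc, hc'⟩ := card_motions_of_independent (a := Z₁ ∘ u) (b := W₁ ∘ u) (z := Z₂ ∘ v)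
    (w := W₂ ∘ v) (l := linkLengths u v p) hZ₁ hW₁ hZ₂ hW₂ hZ₁' hZ₂' hind
  set l := linkLengths u v p with hl
  -- placing the second part at `(A, B)`
  let J : (V₂ → ℂ) → (V₂ → ℂ) → V₁ ⊕ V₂ → Fin 2 → ℂ := fun A B =>
    realise (Sum.elim Z₁ A) (Sum.elim W₁ B)
  have hJ : ∀ A B, Congruent (realise Z₂ W₂) (realise A B) →
      (∀ i, (Z₁ (u i) - A (v i)) * (W₁ (u i) - B (v i)) = l i) →
      ∃ h : Equivalent (joinThree G₁ G₂ u v) p (J A B), restrictClasses G₁ G₂ u v p ⟦⟨J A B, h⟩⟧ =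
        (⟦⟨realise Z₁ W₁, he₁⟩⟧, ⟦⟨realise Z₂ W₂, he₂⟩⟧) := by
    intro A B hAB hlen
    have h : Equivalent (joinThree G₁ G₂ u v) p (J A B) :=
      equivalent_joinThree.mpr ⟨he₁, he₂.trans_congruent hAB, funext fun i => by
        rw [linkLengths_realise]; exact (hlen i).symm⟩
    exact ⟨h, Prod.ext rfl (Quotient.sound hAB.symm)⟩
  -- Congruent placements agree on the normal triangle of the first part, hence everywhere.
  have hJinj : ∀ A B A' B', Congruent (J A B) (J A' B') → A' = A ∧ B' = B := by
    intro A B A' B' h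
    have hn : IsNormal (Sum.elim Z₁ A) (Sum.elim W₁ B) (Sum.inl ∘ u : Fin 3 → V₁ ⊕ V₂) :=
      ⟨hn₁.1, hn₁.2, hn₁.3, hn₁.4, hn₁.5⟩
    obtain ⟨e1, e2⟩ := hn.eq_of_congruent (Z' := Sum.elim Z₁ A')
      (W' := Sum.elim W₁ B') (fun _ => rfl) (fun _ => rfl) h
    exact ⟨funext fun a => congrFun e1 (.inr a), funext fun a => congrFun e2 (.inr a)⟩
  have hpos : ∀ x : motions (Z₁ ∘ u) (W₁ ∘ u) (Z₂ ∘ v) (W₂ ∘ v) l, _ := fun x =>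
    hJ (moveZ Z₂ x) (moveW W₂ x) (congruent_move Z₂ W₂ x.2.1) x.2.2
  have hneg : ∀ x : motions (Z₁ ∘ u) (W₁ ∘ u) (W₂ ∘ v) (Z₂ ∘ v) l, _ := fun x =>
    hJ (moveZ W₂ x) (moveW Z₂ x)
      ((congruent_realise_swap Z₂ W₂).trans (congruent_move W₂ Z₂ x.2.1)) x.2.2
  let Φ : motions (Z₁ ∘ u) (W₁ ∘ u) (Z₂ ∘ v) (W₂ ∘ v) l ⊕
      motions (Z₁ ∘ u) (W₁ ∘ u) (W₂ ∘ v) (Z₂ ∘ v) l →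
      {c // restrictClasses G₁ G₂ u v p c = (⟦⟨realise Z₁ W₁, he₁⟩⟧, ⟦⟨realise Z₂ W₂, he₂⟩⟧)} :=
    Sum.elim (fun x => ⟨⟦⟨_, (hpos x).choose⟩⟧, (hpos x).choose_spec⟩)
      (fun x => ⟨⟦⟨_, (hneg x).choose⟩⟧, (hneg x).choose_spec⟩)
  have hmove : ∀ (A B A' B' : V₂ → ℂ) (x x' : ℂ × ℂ × ℂ), A (v 0) = 0 → A' (v 0) = 0 →
      B (v 0) = 0 → B' (v 0) = 0 → moveZ A x = moveZ A' x' → moveW B x = moveW B' x' →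
      x.2 = x'.2 ∧ x.1 * A (v 1) = x'.1 * A' (v 1) ∧ x.1 * A (v 2) = x'.1 * A' (v 2) := by
    intro A B A' B' x x' hA hA' hB hB' h1 h2
    have e1 := congrFun h1 (v 0)
    have e2 := congrFun h2 (v 0)
    have e3 := congrFun h1 (v 1)
    have e4 := congrFun h1 (v 2)
    simp only [moveZ, moveW, hA, hA', hB, hB', mul_zero, zero_add] at e1 e2 e3 e4
    rw [e1] at e3 e4
    exact ⟨Prod.ext e1 e2, add_right_cancel e3, add_right_cancel e4⟩
  -- A placement that is both direct and exchanged would make W₂ proportional to Z₂ on the triangle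
  -- v, against `W_two`.
  have hmixed : ∀ x x' : ℂ × ℂ × ℂ, x'.1 ≠ 0 → moveZ Z₂ x = moveZ W₂ x' →
      moveW W₂ x = moveW Z₂ x' → False := by
    intro x x' hx' h1 h2
    obtain ⟨-, e1, e2⟩ := hmove _ _ _ _ _ _ hZ₂ hW₂ hW₂ hZ₂ h1 h2
    rw [hZ₂', mul_one] at e1
    apply hn₂.W_two
    apply mul_left_cancel₀ hx'
    rw [← e2, e1]; ring
  have hΦ : Function.Bijective Φ := by
    constructor
    · rintro (x | x) (x' | x') h
      · have hcong : Congruent (J _ _) (J _ _) := Quotient.exact (congrArg Subtype.val h)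
        obtain ⟨e1, e2⟩ := hJinj _ _ _ _ hcong
        obtain ⟨e3, e4, -⟩ := hmove _ _ _ _ _ _ hZ₂ hZ₂ hW₂ hW₂ e1 e2
        rw [hZ₂', mul_one, mul_one] at e4
        exact congrArg Sum.inl (Subtype.ext (Prod.ext e4 e3).symm)
      · have hcong : Congruent (J _ _) (J _ _) := Quotient.exact (congrArg Subtype.val h)
        obtain ⟨e1, e2⟩ := hJinj _ _ _ _ hcong
        exact (hmixed _ _ x'.2.1 e1.symm e2.symm).elim
      · have hcong : Congruent (J _ _) (J _ _) := Quotient.exact (congrArg Subtype.val h)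
        obtain ⟨e1, e2⟩ := hJinj _ _ _ _ hcong
        exact (hmixed _ _ x.2.1 e1 e2).elim
      · have hcong : Congruent (J _ _) (J _ _) := Quotient.exact (congrArg Subtype.val h)
        obtain ⟨e1, e2⟩ := hJinj _ _ _ _ hcong
        obtain ⟨e3, e4, -⟩ := hmove _ _ _ _ _ _ hW₂ hW₂ hZ₂ hZ₂ e1 e2
        exact congrArg Sum.inr (Subtype.ext (Prod.ext (mul_right_cancel₀ hn₂.W_one e4) e3).symm)
    · rintro ⟨c, hcy⟩
      induction c using Quotient.inductionOn with
      | _ q =>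
      obtain ⟨q, hq⟩ := q
      have h1 : Congruent (q ∘ .inl) (realise Z₁ W₁) := Quotient.exact (congrArg Prod.fst hcy)
      have h2 : Congruent (q ∘ .inr) (realise Z₂ W₂) := Quotient.exact (congrArg Prod.snd hcy)
      -- move the first part into its standard place
      obtain ⟨A, B, hAB⟩ : ∃ A B : V₂ → ℂ, Congruent q (J A B) := by
        obtain ⟨x, hx, hx'⟩ := hn₁.exists_motion (Z' := isoZ q ∘ .inl) (W' := isoW q ∘ .inl)
          fun a b => by rw [← d_realise Z₁ W₁, ← h1 a b]; exact (d_sub_eq q _ _).symm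
        rcases hx' with ⟨e1, e2⟩ | ⟨e1, e2⟩
        · refine ⟨fun a => x.1⁻¹ * (isoZ q (.inr a) - x.2.1), fun a => x.1 * (isoW q (.inr a) - x.2.2),
            (congruent_realise_iso q).trans (Congruent.trans (q := realise
              (fun a => x.1⁻¹ * (isoZ q a - x.2.1)) (fun a => x.1 * (isoW q a - x.2.2)))
              (congruent_realise fun a b => by field_simp; ring) ?_)⟩
          have e3 : (fun a => x.1⁻¹ * (isoZ q a - x.2.1)) =
              Sum.elim Z₁ fun a => x.1⁻¹ * (isoZ q (.inr a) - x.2.1) := by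
            ext (a | a)
            · have := congrFun e1 a
              simp only [Function.comp_apply, moveZ] at this
              rw [this, Sum.elim_inl, add_sub_cancel_right, inv_mul_cancel_left₀ hx]
            · rfl
          have e4 : (fun a => x.1 * (isoW q a - x.2.2)) =
              Sum.elim W₁ fun a => x.1 * (isoW q (.inr a) - x.2.2) := by
            ext (a | a)
            · have := congrFun e2 a
              simp only [Function.comp_apply, moveW] at this
              rw [this, Sum.elim_inl, add_sub_cancel_right, mul_inv_cancel_left₀ hx]
            · rfl
          rw [e3, e4]
          exact fun _ _ => rfl
        -- Here the first part is reflected in q, so the isotropic coordinates of all of q are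
        -- exchanged before the translation and scaling are undone.
        · refine ⟨fun a => x.1 * (isoW q (.inr a) - x.2.2), fun a => x.1⁻¹ * (isoZ q (.inr a) - x.2.1),
            (congruent_realise_iso q).trans (Congruent.trans (q := realise
              (fun a => x.1 * (isoW q a - x.2.2)) (fun a => x.1⁻¹ * (isoZ q a - x.2.1)))
              (congruent_realise fun a b => by field_simp; ring) ?_)⟩
          have e3 : (fun a => x.1⁻¹ * (isoZ q a - x.2.1)) =
              Sum.elim W₁ fun a => x.1⁻¹ * (isoZ q (.inr a) - x.2.1) := by
            ext (a | a)
            · have := congrFun e1 a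
              simp only [Function.comp_apply, moveZ] at this
              rw [this, Sum.elim_inl, add_sub_cancel_right, inv_mul_cancel_left₀ hx]
            · rfl
          have e4 : (fun a => x.1 * (isoW q a - x.2.2)) =
              Sum.elim Z₁ fun a => x.1 * (isoW q (.inr a) - x.2.2) := by
            ext (a | a)
            · have := congrFun e2 a
              simp only [Function.comp_apply, moveW] at this
              rw [this, Sum.elim_inl, add_sub_cancel_right, mul_inv_cancel_left₀ hx]
            · rfl
          rw [e3, e4]
          exact fun _ _ => rfl
      have hlen : ∀ i, (Z₁ (u i) - A (v i)) * (W₁ (u i) - B (v i)) = l i := fun i => by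
        have := congrFun (equivalent_joinThree.mp (hq.trans_congruent hAB)).2.2 i
        rw [linkLengths_realise] at this
        exact this.symm
      obtain ⟨x, hx, hx'⟩ := hn₂.exists_motion (Z' := A) (W' := B) fun a b => by
        rw [← d_realise Z₂ W₂, ← h2 a b]
        exact (d_realise _ _ (Sum.inr a) (Sum.inr b)).symm.trans (hAB (.inr a) (.inr b)).symm
      rcases hx' with ⟨rfl, rfl⟩ | ⟨rfl, rfl⟩
      · exact ⟨Sum.inl ⟨x, hx, hlen⟩, Subtype.ext (Quotient.sound hAB.symm)⟩
      · exact ⟨Sum.inr ⟨x, hx, hlen⟩, Subtype.ext (Quotient.sound hAB.symm)⟩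
  have hf : Finite (motions (Z₁ ∘ u) (W₁ ∘ u) (Z₂ ∘ v) (W₂ ∘ v) l) :=
    Set.finite_of_ncard_ne_zero (by rw [hc]; norm_num)
  have hf' : Finite (motions (Z₁ ∘ u) (W₁ ∘ u) (W₂ ∘ v) (Z₂ ∘ v) l) :=
    Set.finite_of_ncard_ne_zero (by rw [hc']; norm_num)
  rw [← Nat.card_eq_of_bijective Φ hΦ, Nat.card_sum, Nat.card_coe_set_eq, Nat.card_coe_set_eq, hc, hc']

/-- Every fibre over the full product has 12 elements, so restriction is automatically onto, and the
formula holds in ℕ∞ before finiteness is known. -/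
theorem numClasses_joinThree {V₁ V₂ : Type*} [Finite V₁] [Finite V₂] {G₁ : SimpleGraph V₁}
    {G₂ : SimpleGraph V₂} {u : Fin 3 → V₁} {v : Fin 3 → V₂} {p : V₁ ⊕ V₂ → Fin 2 → ℂ}
    (hu : Function.Injective u) (hv : Function.Injective v)
    (hr : (2 * Nat.card (V₁ ⊕ V₂) : ℕ∞) ≤
      (matroid ℚ ℂ).eRk (edgeLengths (joinThree G₁ G₂ u v) p) + 3) :
    numClasses (joinThree G₁ G₂ u v) p =
      12 * numClasses G₁ (p ∘ .inl) * numClasses G₂ (p ∘ .inr) := by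
  have e : ∀ y, Nonempty ({c // restrictClasses G₁ G₂ u v p c = y} ≃ Fin 12) := fun y => by
    have h := card_fibre_restrictClasses hu hv hr y
    have : Finite {c // restrictClasses G₁ G₂ u v p c = y} :=
      Nat.finite_of_card_ne_zero (by rw [h]; norm_num)
    exact ⟨Finite.equivFinOfCardEq h⟩
  have e' := ((Equiv.sigmaFiberEquiv (restrictClasses G₁ G₂ u v p)).symm.trans
    (Equiv.sigmaCongrRight fun y => (e y).some)).trans (Equiv.sigmaEquivProd _ _)
  rw [numClasses, ENat.card_congr e', ENat.card_prod, ENat.card_prod, numClasses, numClasses,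
    ENat.card_eq_coe_natCard (Fin 12), Nat.card_fin]
  push_cast
  ring

end PlaneFramework

end

/-! ### Independence of the generic point, finiteness, and rigidity of the parts -/

section

open AlgebraicIndependent Filter Topology

/-- Any two finite families of algebraically independent complex numbers are conjugate under a
field automorphism. -/
theorem Complex.exists_ringEquiv_of_algebraicIndependent {ι : Type*} [Finite ι] {p q : ι → ℂ}
    (hp : AlgebraicIndependent ℚ p) (hq : AlgebraicIndependent ℚ q) :
    ∃ σ : ℂ ≃+* ℂ, ∀ i, σ (p i) = q i := by
  obtain ⟨s, hps, hs⟩ := exists_isTranscendenceBasis_superset hp.coe_range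
  obtain ⟨t, hqt, ht⟩ := exists_isTranscendenceBasis_superset hq.coe_range
  have hC : Cardinal.aleph0 < Cardinal.mk ℂ := by
    rw [Cardinal.mk_complex]; exact Cardinal.aleph0_lt_continuum
  have hcs := IsAlgClosed.cardinal_eq_cardinal_transcendence_basis_of_aleph0_lt' _ hs
    Cardinal.mk_le_aleph0 hC
  have hct := IsAlgClosed.cardinal_eq_cardinal_transcendence_basis_of_aleph0_lt' _ ht
    Cardinal.mk_le_aleph0 hC
  let e₀ : ι ≃ Set.range p := Equiv.ofInjective p hp.injective
  let s₀ : Set s := {x | (x : ℂ) ∈ Set.range p}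
  let f : s₀ ↪ t := ⟨fun x => ⟨q (e₀.symm ⟨x.1, x.2⟩), hqt ⟨_, rfl⟩⟩, fun x y h => by
    have h1 := e₀.symm.injective (hq.injective (congrArg Subtype.val h))
    exact Subtype.ext (Subtype.ext (Subtype.mk.inj h1))⟩
  have hs₀ : s₀.Finite := (Set.finite_range p).preimage Subtype.val_injective.injOn
  -- Both transcendence bases have the cardinality of ℂ and the prescribed part is finite, so p i ↦
  -- q i extends to a bijection of the bases; passing to algebraic closures gives σ.
  obtain ⟨g, hg⟩ := Cardinal.extend_function_of_lt f
    (hs₀.lt_aleph0.trans (hcs ▸ hC)) (Cardinal.eq.mp (hcs.symm.trans hct))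
  have ht' : IsTranscendenceBasis ℚ ((↑) ∘ g : s → ℂ) := ht.comp_equiv g
  let := IsAlgClosed.isAlgClosure_of_transcendence_basis _ hs
  let := IsAlgClosed.isAlgClosure_of_transcendence_basis _ ht'
  let φ := (hs.1.aevalEquiv.symm.trans ht'.1.aevalEquiv).toRingEquiv
  refine ⟨IsAlgClosure.equivOfEquiv ℂ ℂ φ, fun i => ?_⟩
  have h1 : p i = algebraMap (Algebra.adjoin ℚ (Set.range ((↑) : s → ℂ))) ℂ
      (hs.1.aevalEquiv (.X ⟨p i, hps ⟨i, rfl⟩⟩)) := by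
    rw [algebraMap_aevalEquiv, MvPolynomial.aeval_X]
  rw [h1, IsAlgClosure.equivOfEquiv_algebraMap]
  have h2 : φ (hs.1.aevalEquiv (.X ⟨p i, hps ⟨i, rfl⟩⟩)) =
      ht'.1.aevalEquiv (.X ⟨p i, hps ⟨i, rfl⟩⟩) := by
    simp [φ]
  rw [h2, algebraMap_aevalEquiv, MvPolynomial.aeval_X]
  have h3 : g ⟨p i, hps ⟨i, rfl⟩⟩ = _ := hg ⟨⟨p i, hps ⟨i, rfl⟩⟩, ⟨i, rfl⟩⟩
  rw [Function.comp_apply, h3]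
  change q (e₀.symm (e₀ i)) = q i
  rw [Equiv.symm_apply_apply]

/-- An independent family can be extended along an injection of index types, provided that there
is some independent family on the larger index type. -/
theorem AlgebraicIndependent.exists_extension {ι κ K : Type*} [Finite κ] [Field K] [Algebra ℚ K]
    {f : ι → κ} (hf : Function.Injective f) {p : ι → K} (hp : AlgebraicIndependent ℚ p)
    {q : κ → K} (hq : AlgebraicIndependent ℚ q) :
    ∃ P : κ → K, AlgebraicIndependent ℚ P ∧ ∀ i, P (f i) = p i := by
  classical
  have hfι : Finite ι := Finite.of_injective f hf
  obtain ⟨s, hps, hs⟩ := exists_isTranscendenceBasis_superset hp.coe_range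
  have hs' : (matroid ℚ K).IsBase s := hs
  -- The family q shows that the transcendence degree is at least |κ|, so a basis containing p has
  -- enough spare elements for the indices outside the range of f.
  have h1 : ENat.card κ ≤ s.encard := by
    rw [hs'.encard_eq_eRank, ← hq.eRk_range]
    exact Matroid.eRk_le_eRank _ _
  have h2 : (Set.range f)ᶜ.encard ≤ (s \ Set.range p).encard := by
    have h3 := Set.encard_sdiff_add_encard_of_subset hps
    have h4 := Set.encard_add_encard_compl (Set.range f)
    rw [Set.encard_univ] at h4
    have h5 : (Set.range f).encard = (Set.range p).encard := by
      rw [← Set.image_univ, ← Set.image_univ, hf.encard_image, hp.injective.encard_image]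
    rw [← h4, ← h3, h5, add_comm] at h1
    exact (ENat.add_le_add_iff_right (Set.finite_range p).encard_lt_top.ne).mp h1
  obtain ⟨t, hts, ht⟩ := Set.exists_subset_encard_eq h2
  have htfin : t.Finite := Set.encard_lt_top_iff.mp (ht ▸ (Set.toFinite _).encard_lt_top)
  have := htfin.to_subtype
  obtain ⟨e⟩ : Nonempty (((Set.range f)ᶜ : Set κ) ≃ t) := by
    rw [← Finite.card_eq]
    have := congrArg ENat.toNat ht
    exact this.symm
  let P : κ → K := fun k => if h : k ∈ Set.range f then p h.choose else e ⟨k, h⟩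
  have hPf : ∀ i, P (f i) = p i := fun i => by
    have h : f i ∈ Set.range f := ⟨i, rfl⟩
    simp only [P, dif_pos h]
    rw [hf h.choose_spec]
  have hPe : ∀ k (h : k ∉ Set.range f), P k = e ⟨k, h⟩ := fun k h => by
    simp only [P, dif_neg h]
  have hPs : ∀ k, P k ∈ s := fun k => by
    by_cases h : k ∈ Set.range f
    · obtain ⟨i, rfl⟩ := h
      rw [hPf]; exact hps ⟨i, rfl⟩
    · rw [hPe k h]; exact (hts (e ⟨k, h⟩).2).1
  have hPinj : Function.Injective P := by
    intro k k' h
    by_cases hk : k ∈ Set.range f <;> by_cases hk' : k' ∈ Set.range f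
    · obtain ⟨i, rfl⟩ := hk
      obtain ⟨j, rfl⟩ := hk'
      rw [hPf, hPf] at h
      rw [hp.injective h]
    · obtain ⟨i, rfl⟩ := hk
      rw [hPf, hPe k' hk'] at h
      exact absurd ⟨i, h⟩ (hts (e ⟨k', hk'⟩).2).2
    · obtain ⟨i, rfl⟩ := hk'
      rw [hPf, hPe k hk] at h
      exact absurd ⟨i, h.symm⟩ (hts (e ⟨k, hk⟩).2).2
    · rw [hPe k hk, hPe k' hk'] at h
      exact congrArg Subtype.val (e.injective (Subtype.ext h))
  refine ⟨P, ?_, hPf⟩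
  exact hs.1.comp (fun k => ⟨P k, hPs k⟩) fun k k' h => hPinj (congrArg Subtype.val h)

namespace PlaneFramework

theorem IsGeneric.comp {V U K : Type*} [CommRing K] [Algebra ℚ K] {p : U → Fin 2 → K}
    (hp : IsGeneric p) {f : V → U} (hf : Function.Injective f) : IsGeneric (p ∘ f) :=
  AlgebraicIndependent.comp hp (fun x : V × Fin 2 => (f x.1, x.2)) fun x y h => by
    simp only [Prod.mk.injEq] at h
    exact Prod.ext (hf h.1) h.2

theorem IsGeneric.exists_extension {V U K : Type*} [Finite U] [Field K] [Algebra ℚ K]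
    {f : V → U} (hf : Function.Injective f) {p : V → Fin 2 → K} (hp : IsGeneric p)
    {q : U → Fin 2 → K} (hq : IsGeneric q) : ∃ P : U → Fin 2 → K, IsGeneric P ∧ P ∘ f = p := by
  obtain ⟨P, hP, hPf⟩ := AlgebraicIndependent.exists_extension
    (f := fun x : V × Fin 2 => (f x.1, x.2))
    (fun x y h => by
      simp only [Prod.mk.injEq] at h
      exact Prod.ext (hf h.1) h.2) hp hq
  exact ⟨Function.curry P, hP, funext fun a => funext fun i => hPf (a, i)⟩

theorem d_map {K : Type*} [CommRing K] (σ : K ≃+* K) (P Q : Fin 2 → K) :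
    d ((fun i => σ (P i)) - fun i => σ (Q i)) = σ (d (P - Q)) := by
  simp [d]

/-- The number of classes is invariant under field automorphisms. -/
theorem numClasses_map {V : Type*} (G : SimpleGraph V) (p : V → Fin 2 → ℂ) (σ : ℂ ≃+* ℂ) :
    numClasses G (fun a i => σ (p a i)) = numClasses G p := by
  refine (ENat.card_congr (Quotient.congr (Equiv.subtypeEquiv
    (Equiv.arrowCongr (Equiv.refl V) (Equiv.arrowCongr (Equiv.refl (Fin 2)) σ.toEquiv)) ?_) ?_)).symm
  · intro q
    refine forall_congr' fun a => forall_congr' fun b => imp_congr_right fun _ => ?_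
    change _ ↔ d ((fun i => σ (p a i)) - fun i => σ (p b i)) =
      d ((fun i => σ (q a i)) - fun i => σ (q b i))
    rw [d_map, d_map, σ.injective.eq_iff]
  · rintro ⟨q, hq⟩ ⟨q', hq'⟩
    refine forall_congr' fun a => forall_congr' fun b => ?_
    change _ ↔ d ((fun i => σ (q a i)) - fun i => σ (q b i)) =
      d ((fun i => σ (q' a i)) - fun i => σ (q' b i))
    rw [d_map, d_map, σ.injective.eq_iff]

/-- Some automorphism of ℂ carries p to q, and it transports equivalence and congruence. -/
theorem numClasses_eq_of_generic {V : Type*} [Finite V] (G : SimpleGraph V) {p q : V → Fin 2 → ℂ}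
    (hp : IsGeneric p) (hq : IsGeneric q) : numClasses G q = numClasses G p := by
  obtain ⟨σ, hσ⟩ := Complex.exists_ringEquiv_of_algebraicIndependent hp hq
  rw [← numClasses_map G p σ]
  congr
  ext a i
  exact (hσ (a, i)).symm

theorem hasRealisationNumber_of_generic {V : Type*} [Finite V] {G : SimpleGraph V}
    {p : V → Fin 2 → ℂ} (hp : IsGeneric p) {n : ℕ} (h : numClasses G p = n) :
    HasRealisationNumber G n :=
  ⟨⟨p, hp⟩, fun _ hq => (numClasses_eq_of_generic G hp hq).trans h⟩

section MaximalRank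

variable {V : Type*} [Finite V] {G : SimpleGraph V}

/-- In a generic framework of maximal rank, every squared distance takes only finitely many values
on the equivalent frameworks. -/
theorem exists_polynomial_of_rank {p : V → Fin 2 → ℂ} (hp : IsGeneric p)
    (hr : (2 * Nat.card V : ℕ∞) ≤ (matroid ℚ ℂ).eRk (edgeLengths G p) + 3) (a b : V) :
    ∃ H : Polynomial ℂ, H ≠ 0 ∧
      ∀ q : V → Fin 2 → ℂ, Equivalent G p q → H.IsRoot (d (q a - q b)) := by
  have hp' : AlgebraicIndependent ℚ (Function.uncurry p) := hp
  have h := d_mem_algClosure hr a b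
  rw [mem_algClosure, mem_matroid_closure_iff] at h
  obtain ⟨H, hH, hroot⟩ := MvPolynomial.exists_polynomial_of_isAlgebraic hp'
    (fun e : {e : V × V // G.Adj e.1 e.2} => lengthPoly e.1.1 e.1.2) (lengthPoly a b)
    (by
      rw [funext fun e : {e : V × V // G.Adj e.1 e.2} =>
        aeval_lengthPoly (Function.uncurry p) e.1.1 e.1.2, aeval_lengthPoly]
      exact h)
  refine ⟨H, hH, fun q hq => ?_⟩
  have := hroot (Function.uncurry q) fun e => by
    rw [aeval_lengthPoly, aeval_lengthPoly]
    exact (hq _ _ e.2).symm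
  rwa [aeval_lengthPoly] at this

/-- A class is determined by its squared distances, each of which is a root of a fixed nonzero
polynomial. -/
theorem numClasses_ne_top_of_rank {p : V → Fin 2 → ℂ} (hp : IsGeneric p)
    (hr : (2 * Nat.card V : ℕ∞) ≤ (matroid ℚ ℂ).eRk (edgeLengths G p) + 3) :
    numClasses G p ≠ ⊤ := by
  choose H hH hroot using exists_polynomial_of_rank hp hr
  let F : Quotient (congruenceSetoid G p) → ∀ e : V × V, {x // (H e.1 e.2).IsRoot x} :=
    Quotient.lift (fun q e => ⟨d (q.1 e.1 - q.1 e.2), hroot _ _ _ q.2⟩) fun _ _ h =>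
      funext fun e => Subtype.ext (h e.1 e.2)
  have hF : Function.Injective F := by
    intro x y
    induction x using Quotient.inductionOn
    induction y using Quotient.inductionOn
    intro h
    exact Quotient.sound fun a b => congrArg Subtype.val (congrFun h (a, b))
  have : ∀ e : V × V, Finite {x // (H e.1 e.2).IsRoot x} := fun e =>
    (H e.1 e.2).finite_setOfPred_isRoot (hH _ _)
  have := Finite.of_injective F hF
  rw [numClasses, ENat.card_eq_coe_natCard]
  exact ENat.natCast_ne_top _

/-- On equivalent frameworks each squared distance ranges over a finite set, so by continuity it
cannot change near p. This is the converse of `IsRigidFramework.le_eRk_edgeLengths`. -/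
theorem isRigidFramework_of_rank {p : V → Fin 2 → ℝ} (hp : IsGeneric p)
    (hr : (2 * Nat.card V : ℕ∞) ≤ (matroid ℚ ℂ).eRk (edgeLengths G (complexify p)) + 3) :
    IsRigidFramework G p := by
  have := Fintype.ofFinite V
  choose H hH hroot using exists_polynomial_of_rank (isGeneric_complexify hp) hr
  have hev : ∀ᶠ q : V → Fin 2 → ℝ in 𝓝 p, ∀ a b,
      (H a b).IsRoot (d (q a - q b) : ℝ) → d (q a - q b) = d (p a - p b) := by
    rw [eventually_all]
    intro a
    rw [eventually_all]
    intro b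
    have hfin : ({x : ℝ | (H a b).IsRoot (x : ℂ)} \ {d (p a - p b)}).Finite :=
      (((H a b).finite_setOfPred_isRoot (hH a b)).preimage
        Complex.ofReal_injective.injOn).subset Set.sdiff_subset
    have hc : Continuous fun q : V → Fin 2 → ℝ => d (q a - q b) := by
      simp only [d, Pi.sub_apply]; fun_prop
    filter_upwards [hc.continuousAt.eventually (hfin.isClosed.isOpen_compl.mem_nhds (by simp))]
      with q hq hr
    by_contra hne
    exact hq ⟨hr, hne⟩
  obtain ⟨δ, hδ, hball⟩ := Metric.eventually_nhds_iff.mp hev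
  -- Closeness in `IsRigidFramework` is measured by squared distances, hence the square.
  refine ⟨δ ^ 2, by positivity, fun q hq hclose a b => ?_⟩
  have hdist : dist q p < δ := by
    rw [dist_pi_lt_iff hδ]
    intro a
    rw [dist_pi_lt_iff hδ]
    intro i
    rw [Real.dist_eq]
    apply abs_lt_of_sq_lt_sq _ hδ.le
    have := hclose a
    simp only [d, Pi.sub_apply] at this
    fin_cases i
    · simp only [Fin.zero_eta]
      nlinarith [sq_nonneg (p a 1 - q a 1)]
    · simp only [Fin.mk_one]
      nlinarith [sq_nonneg (p a 0 - q a 0)]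
  refine (hball hdist a b ?_).symm
  have := hroot a b (complexify q) fun x y hxy => by
    rw [d_complexify, d_complexify, hq x y hxy]
  rwa [d_complexify] at this

end MaximalRank

/-- Every generic realisation of a part extends to one of the whole graph, whose maximal rank passes
to the part and gives rigidity there. -/
theorem isRigid_parts {V₁ V₂ : Type*} [Finite V₁] [Finite V₂] {G₁ : SimpleGraph V₁}
    {G₂ : SimpleGraph V₂} {u : Fin 3 → V₁} {v : Fin 3 → V₂}
    (hu : Function.Injective u) (hv : Function.Injective v)
    (hG : IsRigid (joinThree G₁ G₂ u v)) : IsRigid G₁ ∧ IsRigid G₂ := by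
  obtain ⟨⟨p₀, hp₀⟩, hG⟩ := hG
  have hrank : ∀ p : V₁ ⊕ V₂ → Fin 2 → ℝ, IsGeneric p → _ := fun p hp =>
    rank_parts hu hv (le_eRk_edgeLengths_complexify hp (hG p hp)
      (a := .inl (u 0)) (b := .inl (u 1)) (by simp [hu.eq_iff]))
  refine ⟨⟨⟨p₀ ∘ .inl, hp₀.comp Sum.inl_injective⟩, fun p hp => ?_⟩,
    ⟨⟨p₀ ∘ .inr, hp₀.comp Sum.inr_injective⟩, fun p hp => ?_⟩⟩
  · obtain ⟨P, hP, rfl⟩ := hp.exists_extension Sum.inl_injective hp₀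
    exact isRigidFramework_of_rank hp (hrank P hP).1
  · obtain ⟨P, hP, rfl⟩ := hp.exists_extension Sum.inr_injective hp₀
    exact isRigidFramework_of_rank hp (hrank P hP).2

end PlaneFramework

end

theorem mainTheorem5 {V₁ V₂ : Type*} [Finite V₁] [Finite V₂]
    (G₁ : SimpleGraph V₁) (G₂ : SimpleGraph V₂)
    (u : Fin 3 → V₁) (v : Fin 3 → V₂)
    (hu : Function.Injective u) (hv : Function.Injective v)
    (hG : PlaneFramework.IsRigid (PlaneFramework.joinThree G₁ G₂ u v)) :
    PlaneFramework.IsRigid G₁ ∧ PlaneFramework.IsRigid G₂ ∧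
      ∃ n₁ n₂ : ℕ,
        PlaneFramework.HasRealisationNumber G₁ n₁ ∧
        PlaneFramework.HasRealisationNumber G₂ n₂ ∧
        PlaneFramework.HasRealisationNumber (PlaneFramework.joinThree G₁ G₂ u v)
          (12 * n₁ * n₂) := by
  obtain ⟨hG₁, hG₂⟩ := PlaneFramework.isRigid_parts hu hv hG
  refine ⟨hG₁, hG₂, ?_⟩
  obtain ⟨⟨p, hp⟩, hG⟩ := hG
  have hr := PlaneFramework.le_eRk_edgeLengths_complexify hp (hG p hp)
    (a := .inl (u 0)) (b := .inl (u 1)) (by simp [hu.eq_iff])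
  obtain ⟨hr₁, hr₂⟩ := PlaneFramework.rank_parts hu hv hr
  have hP := PlaneFramework.isGeneric_complexify hp
  have hP₁ := hP.comp Sum.inl_injective
  have hP₂ := hP.comp Sum.inr_injective
  obtain ⟨n₁, h₁⟩ := ENat.ne_top_iff_exists.mp (PlaneFramework.numClasses_ne_top_of_rank hP₁ hr₁)
  obtain ⟨n₂, h₂⟩ := ENat.ne_top_iff_exists.mp (PlaneFramework.numClasses_ne_top_of_rank hP₂ hr₂)
  refine ⟨n₁, n₂, PlaneFramework.hasRealisationNumber_of_generic hP₁ h₁.symm,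
    PlaneFramework.hasRealisationNumber_of_generic hP₂ h₂.symm,
    PlaneFramework.hasRealisationNumber_of_generic hP ?_⟩
  rw [PlaneFramework.numClasses_joinThree hu hv hr, ← h₁, ← h₂]
  push_cast
  rfl
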